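/- **Setting.** Let $N\ge 2$ be an integer, let $\mathbb{T}=\{z\in\mathbb{C}: |z|=1\}$, and identify functions on $\mathbb{T}$ with $2\pi$-periodic functions on $\mathbb{R}$ via $z=e^{ix}$. Let $m_0:\mathbb{T}\to\mathbb{C}$ be a Lipschitz function with only finitely many zeros, with $m_0(0)=\sqrt N$ (that is, the value of $m_0$ at the point $z=1$ is $\sqrt N$), and such that $R1=1$, where $$Rf(z)=\frac1N\sum_{w^N=z}|m_0(w)|^2f(w)\qquad(z\in\mathbb{T}).$$ A cycle of length $p\ge1$, written $z_1\to\dots\to z_p\to z_1$, is a set $\{z_1,\dots,z_p\}\subset\mathbb{T}$ of $p$ distinct points with $z_1^N=z_2,\dots,z_{p-1}^N=z_p,\ z_p^N=z_1$; it is an $m_0$-cycle if $|m_0(z_j)|=\sqrt N$ for all $j$. Write $\alpha_\rho(f)(z)=f(\rho z)$ for $\rho\in\mathbb{T}$, $f^{(n)}(z)=f(z)f(z^N)\cdots f(z^{N^{n-1}})$ for $n\geq 1$, and $\operatorname{Per}(\varphi)(x)=\sum_{k\in\mathbb{Z}}\varphi(x+2k\pi)$ for $\varphi\in L^1(\mathbb{R})$.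 **Theorem 2.1 (the spectrum of $R$ on $C(\mathbb{T})$).** (i) The spectral radius of the operator $R:C(\mathbb{T})\to C(\mathbb{T})$ is equal to $1$. (ii) Each $\lambda\in\mathbb{C}$ with $|\lambda|<1$ is an eigenvalue of $R$ of infinite multiplicity, and the spectrum of $R$ on $C(\mathbb{T})$ is the closed unit disk $\{\lambda\in\mathbb{C}: |\lambda|\le1\}$. (iii) There are only finitely many $m_0$-cycles. Let $C_1,\dots,C_n$ be the $m_0$-cycles, $C_i=z_{1i}\to\dots\to z_{p_ii}\to z_{1i}$ (with arbitrarily chosen starting points), and let $\lambda\in\mathbb{C}$, $|\lambda|=1$. Then $\lambda$ is an eigenvalue of $R$ if and only if $\lambda^{p_i}=1$ for some $i\in\{1,\dots,n\}$, and the multiplicity of $\lambda$ (the dimension of its eigenspace) equals the cardinality of $\{i\in\{1,\dots,n\}:\lambda^{p_i}=1\}$. A basis of the eigenspace is obtained as follows. For $i\in\{1,\dots,n\}$ and $k\in\{1,\dots,p_i\}$ the infinite product $$\varphi_{ki}(x)=\prod_{l=1}^{\infty}\frac{e^{-i\theta_i}\,\alpha_{z_{ki}}\big(m_0^{(p_i)}\big)\big(\tfrac{x}{N^{lp_i}}\big)}{\sqrt{N^{p_i}}}\quad(x\in\mathbb{R}),\qquad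 e^{i\theta_i}=\prod_{k=1}^{p_i}\frac{m_0(z_{ki})}{|m_0(z_{ki})|},$$ converges for every $x$, $|\varphi_{ki}|^2\in L^1(\mathbb{R})$, the series $\operatorname{Per}|\varphi_{ki}|^2(x)$ converges for every $x$, and we put $$g_{ki}=\alpha_{z_{ki}^{-1}}\big(\operatorname{Per}|\varphi_{ki}|^2\big).$$ Then $$\Big\{\sum_{k=1}^{p_i}\lambda^{-k+1}g_{ki}\ :\ i\in\{1,\dots,n\},\ \lambda^{p_i}=1\Big\}$$ is a basis of the eigenspace of $R$ corresponding to $\lambda$ (the functions being indexed by $i$). Moreover, the functions in this basis are Lipschitz, and they are trigonometric polynomials when $m_0$ is one. -/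

import Mathlib

namespace Galerkin

/-- `(R f)(z) = (1/N) ∑_{w^N = z} |m₀(w)|² f(w)`, the sum being over all `w` in the unit circle
with `w ^ N = z` (a finite set for `N ≥ 1`). -/
noncomputable def ruelleFun (N : ℕ) (m₀ f : Circle → ℂ) (z : Circle) : ℂ :=
  (1 / (N : ℂ)) * ∑ᶠ (w : Circle) (_ : w ^ N = z), ((‖m₀ w‖ ^ 2 : ℝ) : ℂ) * f w

/-- The `N`-th roots of `e^{ix}` are the points `e^{i(x + 2πk)/N}`, `0 ≤ k < N`. -/
theorem ruelleFun_exp {N : ℕ} (hN : N ≠ 0) (m₀ f : Circle → ℂ) (x : ℝ) :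
    ruelleFun N m₀ f (Circle.exp x) = (1 / (N : ℂ)) * ∑ k ∈ Finset.range N,
      ((‖m₀ (Circle.exp ((x + 2 * Real.pi * k) / N))‖ ^ 2 : ℝ) : ℂ) *
        f (Circle.exp ((x + 2 * Real.pi * k) / N)) := by
  have hN' : (N : ℝ) ≠ 0 := Nat.cast_ne_zero.mpr hN
  have hpi : (2 * Real.pi) ≠ 0 := by positivity
  unfold ruelleFun
  congr 1
  rw [← finsum_mem_coe_finset]
  symm
  apply finsum_mem_eq_of_bijOn (s := ((Finset.range N : Finset ℕ) : Set ℕ))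
    (t := {w : Circle | w ^ N = Circle.exp x})
    (fun k : ℕ => Circle.exp ((x + 2 * Real.pi * k) / N))
  · refine ⟨?_, ?_, ?_⟩
    · intro k _
      simp only [Set.mem_ofPred_eq]
      rw [← Circle.exp_natCast_mul, mul_div_cancel₀ _ hN', Circle.exp_eq_exp]
      exact ⟨k, by push_cast; ring⟩
    · intro j hj k hk hjk
      simp only [Finset.coe_range, Set.mem_Iio] at hj hk
      obtain ⟨m, hm⟩ := Circle.exp_eq_exp.mp hjk
      have h1 : (2 * Real.pi) * (j : ℝ) = (2 * Real.pi) * (k + m * N) := by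
        field_simp at hm
        linarith
      have h2 : (j : ℝ) = k + m * N := mul_left_cancel₀ hpi h1
      have h3 : (j : ℤ) = k + m * N := by exact_mod_cast h2
      have h4 : ((j : ℤ)) % N = (k : ℤ) % N := by rw [h3]; simp
      rw [Int.emod_eq_of_lt (by positivity) (by exact_mod_cast hj),
        Int.emod_eq_of_lt (by positivity) (by exact_mod_cast hk)] at h4
      exact_mod_cast h4
    · intro w hw
      obtain ⟨y, rfl⟩ := Circle.exp_surjective w
      simp only [Set.mem_ofPred_eq] at hw
      rw [← Circle.exp_natCast_mul] at hw
      obtain ⟨m, hm⟩ := Circle.exp_eq_exp.mp hw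
      have hNz : (N : ℤ) ≠ 0 := by exact_mod_cast hN
      have hnn : 0 ≤ m % (N : ℤ) := Int.emod_nonneg _ hNz
      refine ⟨(m % (N : ℤ)).toNat, ?_, ?_⟩
      · simp only [Finset.coe_range, Set.mem_Iio]
        have := Int.emod_lt_of_pos m (by positivity : (0 : ℤ) < N)
        omega
      · simp only
        rw [Circle.exp_eq_exp]
        refine ⟨-(m / (N : ℤ)), ?_⟩
        have h5 : (((m % (N : ℤ)).toNat : ℕ) : ℝ) = ((m % (N : ℤ) : ℤ) : ℝ) := by
          have : (((m % (N : ℤ)).toNat : ℕ) : ℤ) = m % (N : ℤ) := Int.toNat_of_nonneg hnn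
          exact_mod_cast this
        have h6 : (m : ℝ) = ((m % (N : ℤ) : ℤ) : ℝ) + N * ((m / (N : ℤ) : ℤ) : ℝ) := by
          exact_mod_cast (Int.emod_add_mul_ediv m N).symm
        rw [h5]
        field_simp
        push_cast
        rw [h6] at hm
        linarith
  · intro k _
    rfl

theorem continuous_ruelleFun (N : ℕ) (m₀ f : C(Circle, ℂ)) :
    Continuous (ruelleFun N m₀ f) := by
  rcases eq_or_ne N 0 with rfl | hN
  · have : ruelleFun 0 m₀ f = fun _ => 0 := by
      funext z
      simp [ruelleFun]
    rw [this]
    exact continuous_const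
  · rw [Circle.isCoveringMap_exp.isQuotientMap Circle.exp_surjective |>.continuous_iff]
    have : ruelleFun N m₀ f ∘ Circle.exp = fun x : ℝ =>
        (1 / (N : ℂ)) * ∑ k ∈ Finset.range N,
          ((‖m₀ (Circle.exp ((x + 2 * Real.pi * k) / N))‖ ^ 2 : ℝ) : ℂ) *
            f (Circle.exp ((x + 2 * Real.pi * k) / N)) := by
      funext x
      exact ruelleFun_exp hN m₀ f x
    rw [this]
    fun_prop

theorem ruelleFun_eq_zero (m₀ f : Circle → ℂ) (z : Circle) : ruelleFun 0 m₀ f z = 0 := by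
  simp [ruelleFun]

/-- The wavelet Galerkin (Ruelle, transfer) operator `R` on `C(𝕋)`, as a bounded operator. -/
noncomputable def ruelleOp (N : ℕ) (m₀ : C(Circle, ℂ)) : C(Circle, ℂ) →L[ℂ] C(Circle, ℂ) :=
  LinearMap.mkContinuous
    { toFun := fun f => ⟨ruelleFun N m₀ f, continuous_ruelleFun N m₀ f⟩
      map_add' := by
        intro f g
        ext z
        obtain ⟨x, rfl⟩ := Circle.exp_surjective z
        rcases eq_or_ne N 0 with rfl | hN
        · simp [ruelleFun_eq_zero]
        · simp [ruelleFun_exp hN, mul_add, Finset.sum_add_distrib]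
      map_smul' := by
        intro c f
        ext z
        obtain ⟨x, rfl⟩ := Circle.exp_surjective z
        rcases eq_or_ne N 0 with rfl | hN
        · simp [ruelleFun_eq_zero]
        · simp [ruelleFun_exp hN, Finset.mul_sum, mul_left_comm] }
    (‖m₀‖ ^ 2)
    (by
      intro f
      rw [ContinuousMap.norm_le _ (by positivity)]
      intro z
      obtain ⟨x, rfl⟩ := Circle.exp_surjective z
      change ‖ruelleFun N m₀ f (Circle.exp x)‖ ≤ _
      rcases eq_or_ne N 0 with rfl | hN
      · rw [ruelleFun_eq_zero, norm_zero]
        positivity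
      · have hN' : (N : ℝ) ≠ 0 := Nat.cast_ne_zero.mpr hN
        rw [ruelleFun_exp hN, norm_mul]
        calc ‖(1 / (N : ℂ))‖ * _ ≤ ‖(1 / (N : ℂ))‖ *
              ∑ k ∈ Finset.range N, (‖m₀‖ ^ 2 * ‖f‖) := by
              gcongr
              refine (norm_sum_le _ _).trans (Finset.sum_le_sum fun k _ => ?_)
              rw [norm_mul, Complex.norm_real, Real.norm_of_nonneg (by positivity)]
              gcongr
              · exact m₀.norm_coe_le_norm _
              · exact f.norm_coe_le_norm _
          _ = ‖m₀‖ ^ 2 * ‖f‖ := by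
              simp
              field_simp)

theorem ruelleOp_apply (N : ℕ) (m₀ f : C(Circle, ℂ)) (z : Circle) :
    ruelleOp N m₀ f z =
      (1 / (N : ℂ)) * ∑ᶠ (w : Circle) (_ : w ^ N = z), ((‖m₀ w‖ ^ 2 : ℝ) : ℂ) * f w := rfl

/-- `z 0 → z 1 → ⋯ → z (p-1) → z 0` is a cycle of length `p` (for `w ↦ w ^ N`);
`finRotate p` is the cyclic successor `k ↦ k + 1 mod p`. -/
def IsCycle (N : ℕ) {p : ℕ} (z : Fin p → Circle) : Prop :=
  0 < p ∧ Function.Injective z ∧ ∀ k, z k ^ N = z (finRotate p k)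

/-- An `m₀`-cycle: a cycle on which `|m₀| = √N`. -/
def IsMCycle (N : ℕ) (m₀ : Circle → ℂ) {p : ℕ} (z : Fin p → Circle) : Prop :=
  IsCycle N z ∧ ∀ k, ‖m₀ (z k)‖ = Real.sqrt N

/-- The set of all `m₀`-cycles, each cycle being regarded as a set of points. -/
def mCycles (N : ℕ) (m₀ : Circle → ℂ) : Set (Set Circle) :=
  {C | ∃ (p : ℕ) (z : Fin p → Circle), IsMCycle N m₀ z ∧ Set.range z = C}

/-- `z 0, …, z (n-1)` is a list of all the `m₀`-cycles, without repetitions; `p i` is the length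
of the `i`-th cycle, whose starting point is arbitrary. -/
def IsMCycleList (N : ℕ) (m₀ : Circle → ℂ) {n : ℕ} (p : Fin n → ℕ)
    (z : (i : Fin n) → Fin (p i) → Circle) : Prop :=
  (∀ i, IsMCycle N m₀ (z i)) ∧
  Function.Injective (fun i => Set.range (z i)) ∧
  Set.range (fun i => Set.range (z i)) = mCycles N m₀

/-- `α_ρ(f)(z) = f(ρ z)`. -/
noncomputable def rot (ρ : Circle) (f : Circle → ℂ) : Circle → ℂ := fun z => f (ρ * z)

/-- `f^{(n)}(z) = f(z) f(z^N) ⋯ f(z^{N^{n-1}})`. -/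
noncomputable def iterProd (N : ℕ) (f : Circle → ℂ) (n : ℕ) : Circle → ℂ :=
  fun z => ∏ j ∈ Finset.range n, f (z ^ N ^ j)

/-- `Per(φ)(x) = ∑_{k ∈ ℤ} φ(x + 2kπ)`. -/
noncomputable def Per (φ : ℝ → ℂ) : ℝ → ℂ := fun x => ∑' k : ℤ, φ (x + 2 * k * Real.pi)

/-- A `2π`-periodic function on `ℝ`, viewed as a function on the unit circle. -/
noncomputable def toCircleFun (F : ℝ → ℂ) : Circle → ℂ := fun z => F (Complex.arg z)

theorem toCircleFun_exp {F : ℝ → ℂ} (hF : Function.Periodic F (2 * Real.pi)) (x : ℝ) :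
    toCircleFun F (Circle.exp x) = F x := by
  obtain ⟨m, hm⟩ := Circle.exp_eq_exp.mp (Circle.exp_arg (Circle.exp x))
  unfold toCircleFun
  rw [hm]
  exact hF.int_mul m x

theorem periodic_Per (φ : ℝ → ℂ) : Function.Periodic (Per φ) (2 * Real.pi) := by
  intro x
  unfold Per
  rw [← (Equiv.addRight (1 : ℤ)).tsum_eq (fun k : ℤ => φ (x + 2 * k * Real.pi))]
  refine tsum_congr fun k => ?_
  simp only [Equiv.coe_addRight]
  push_cast
  congr 1
  ring

/-- `e^{iθ} = ∏_k m₀(z_k) / |m₀(z_k)|`. -/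
noncomputable def cyclePhase (m₀ : Circle → ℂ) {p : ℕ} (z : Fin p → Circle) : ℂ :=
  ∏ k, m₀ (z k) / (‖m₀ (z k)‖ : ℂ)

/-- The factor `e^{-iθ} α_{z_k}(m₀^{(p)})(x / N^{lp}) / √(N^p)`; the real number `y` stands for
the point `e^{iy}` of the circle. -/
noncomputable def phiFactor (N : ℕ) (m₀ : Circle → ℂ) {p : ℕ} (z : Fin p → Circle) (k : Fin p)
    (x : ℝ) (l : ℕ) : ℂ :=
  (cyclePhase m₀ z)⁻¹ * rot (z k) (iterProd N m₀ p) (Circle.exp (x / (N : ℝ) ^ (l * p))) /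
    (Real.sqrt ((N : ℝ) ^ p) : ℂ)

/-- `φ_k(x)`, the product of the factors over `l ≥ 1`. -/
noncomputable def phi (N : ℕ) (m₀ : Circle → ℂ) {p : ℕ} (z : Fin p → Circle) (k : Fin p) :
    ℝ → ℂ :=
  fun x => ∏' l : ℕ, phiFactor N m₀ z k x (l + 1)

/-- `g_k = α_{z_k⁻¹}(Per |φ_k|²)`, a function on the circle. -/
noncomputable def gFun (N : ℕ) (m₀ : Circle → ℂ) {p : ℕ} (z : Fin p → Circle) (k : Fin p) :
    Circle → ℂ :=
  rot (z k)⁻¹ (toCircleFun (Per fun x => ((‖phi N m₀ z k x‖ ^ 2 : ℝ) : ℂ)))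

/-- `∑_{k=1}^{p} λ^{-k+1} g_k`; the index `k` here is shifted to run over `0, …, p-1`. -/
noncomputable def eigenFun (N : ℕ) (m₀ : Circle → ℂ) {p : ℕ} (z : Fin p → Circle) (lam : ℂ) :
    Circle → ℂ :=
  fun t => ∑ k : Fin p, lam ^ (-((k : ℕ) : ℤ)) * gFun N m₀ z k t

/-- Trigonometric polynomials: finite linear combinations of `z ↦ z ^ k`, `k ∈ ℤ`. -/
def IsTrigPoly (f : Circle → ℂ) : Prop :=
  ∃ (s : Finset ℤ) (a : ℤ → ℂ), ∀ z : Circle, f z = ∑ k ∈ s, a k * (z : ℂ) ^ k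

end Galerkin

/-!
Write `W(w) = |m₀(w)|² / N`. The condition `R 1 = 1` says that the numbers `W(w)`, `w ^ N = z`, are
the transition probabilities of a random walk from `z` to its preimages, and `R f` is the
expectation of `f` after one step of this walk. Hence `‖R‖ = 1`. The map `S f = f(z ^ N)` is an
isometric right inverse of `R`, so for `|λ| < 1` the operator `(1 - λ S)⁻¹` embeds the kernel of `R`
into the eigenspace for `λ`; the kernel is a nonzero module over the functions of `z ^ N`, hence
infinite-dimensional (`exists_polynomial_to_ker`, `not_finiteDimensional_eigenspace`). The
spectrum is closed and contained in the closed unit disk, so it is that disk.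

On the unit circle everything rests on a maximum principle
(`exists_isCyclePt_of_isClosed`): a nonempty closed set which contains, with each point, its
preimages of nonzero weight meets an `m₀`-cycle. Indeed, since `W` has finitely many zeros, the
backward tree of a non-periodic point is free of zeros from some level on, so that the closed set
contains the limit `1` of some backward orbit `e^{iθ / Nⁿ}`; and if all points of the set are
periodic, each of them has a single preimage of nonzero weight, of weight `1`. Applied to the set
where `|f|` is maximal, this shows that an eigenfunction `f` for `|λ| = 1` which vanishes on the
cycles is zero. On an `m₀`-cycle the equation `R f = λ f` reads `f(z_k) = λ f(z_{k+1})`, so `f` is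
determined by its values at the starting points of the cycles with `λ ^ p = 1`.

Conversely, `|φ_k(x)|²` is the product of the weights along the backward path that starts at
`z_k e^{ix}` and approaches the cycle, and `g_k(z)` is the probability that the walk from `z` is
asymptotic to the cycle with the phase given by `k` (`hitProb`). First-step analysis gives
`R g_k = g_{k+1}` (`sum_weight_mul_hitProb`). Different paths being different events, the sum of
all the `g_k` over all the cycles is at most `1`; it is lower semicontinuous, `R`-invariant and
equal to `1` on the cycles, so that it equals `1` by the maximum principle
(`sum_hitProb_eq_one`). Therefore each `g_k`, being `1` minus a sum of lower semicontinuous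
functions, is continuous, it is `1` at `z_k` and `0` at the other cycle points, and the functions
`∑ λ^{-k} g_k` form the basis dual to evaluation at the starting points.

Finally, any continuous eigenfunction with `|λ| = 1` is Lipschitz because `R` improves moduli of
continuity by the factor `1 / N` (`exists_lipschitzWith_of_eigen`), and it is a trigonometric
polynomial if `m₀` is one because `R` lowers high degrees (`isTrigPoly_of_eigen`).
-/

namespace Galerkin

/-! ### The operator as a weighted average over preimages -/

theorem finite_pow_eq (N : ℕ) [NeZero N] (z : Circle) : {w : Circle | w ^ N = z}.Finite := by
  have h := (Polynomial.nthRoots N (z : ℂ)).toFinset.finite_toSet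
  refine (h.preimage (f := fun w : Circle => (w : ℂ)) (Circle.coe_injective.injOn)).subset ?_
  intro w hw
  have hw' : w ^ N = z := hw
  simp only [Set.mem_preimage, Finset.mem_coe, Multiset.mem_toFinset,
    Polynomial.mem_nthRoots (NeZero.pos N), ← hw', Circle.coe_pow]

/-- The finite set of all `w` in the circle with `w ^ N = z`. -/
noncomputable def preim (N : ℕ) [NeZero N] (z : Circle) : Finset Circle :=
  (finite_pow_eq N z).toFinset

@[simp] theorem mem_preim {N : ℕ} [NeZero N] {z w : Circle} : w ∈ preim N z ↔ w ^ N = z := by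
  simp [preim]

/-- The weight `W(w) = |m₀(w)|² / N`, so that `(R f)(z) = ∑_{w ^ N = z} W(w) f(w)`. -/
noncomputable def weight (N : ℕ) (m₀ : Circle → ℂ) (w : Circle) : ℝ := ‖m₀ w‖ ^ 2 / N

theorem weight_nonneg (N : ℕ) (m₀ : Circle → ℂ) (w : Circle) : 0 ≤ weight N m₀ w := by
  unfold weight; positivity

theorem weight_eq_zero {N : ℕ} [NeZero N] {m₀ : Circle → ℂ} {w : Circle} :
    weight N m₀ w = 0 ↔ m₀ w = 0 := by
  simp [weight, NeZero.ne N]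

theorem weight_eq_one {N : ℕ} [NeZero N] {m₀ : Circle → ℂ} {w : Circle} :
    weight N m₀ w = 1 ↔ ‖m₀ w‖ = Real.sqrt N := by
  have hN : (N : ℝ) ≠ 0 := Nat.cast_ne_zero.mpr (NeZero.ne N)
  rw [weight, div_eq_one_iff_eq hN, eq_comm (b := Real.sqrt N),
    Real.sqrt_eq_iff_eq_sq (by positivity) (norm_nonneg _), eq_comm]

theorem ruelleFun_eq_sum {N : ℕ} [NeZero N] (m₀ f : Circle → ℂ) (z : Circle) :
    ruelleFun N m₀ f z = ∑ w ∈ preim N z, (weight N m₀ w : ℂ) * f w := by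
  unfold ruelleFun
  rw [show (∑ᶠ (w : Circle) (_ : w ^ N = z), ((‖m₀ w‖ ^ 2 : ℝ) : ℂ) * f w)
    = ∑ w ∈ preim N z, ((‖m₀ w‖ ^ 2 : ℝ) : ℂ) * f w from
    finsum_mem_eq_finite_toFinset_sum _ (finite_pow_eq N z), Finset.mul_sum]
  refine Finset.sum_congr rfl fun w _ => ?_
  simp only [weight]
  push_cast
  ring

theorem ruelleOp_eq_sum {N : ℕ} [NeZero N] (m₀ f : C(Circle, ℂ)) (z : Circle) :
    ruelleOp N m₀ f z = ∑ w ∈ preim N z, (weight N m₀ w : ℂ) * f w :=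
  ruelleFun_eq_sum m₀ f z

theorem sum_preim_exp {N : ℕ} [NeZero N] (f : Circle → ℂ) (x : ℝ) :
    ∑ w ∈ preim N (Circle.exp x), f w =
      ∑ k ∈ Finset.range N, f (Circle.exp ((x + 2 * Real.pi * k) / N)) := by
  have hN : (N : ℂ) ≠ 0 := Nat.cast_ne_zero.mpr (NeZero.ne N)
  have h := ruelleFun_exp (NeZero.ne N) 1 f x
  rw [ruelleFun_eq_sum] at h
  simpa [weight, ← Finset.mul_sum, hN] using h

theorem sum_preim_exp_real {N : ℕ} [NeZero N] (f : Circle → ℝ) (x : ℝ) :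
    ∑ w ∈ preim N (Circle.exp x), f w =
      ∑ k ∈ Finset.range N, f (Circle.exp ((x + 2 * Real.pi * k) / N)) := by
  exact_mod_cast sum_preim_exp (fun w => (f w : ℂ)) x

/-- The condition `R 1 = 1` says that the weights are transition probabilities. -/
theorem sum_weight {N : ℕ} [NeZero N] {m₀ : C(Circle, ℂ)} (hR1 : ruelleOp N m₀ 1 = 1)
    (z : Circle) : ∑ w ∈ preim N z, weight N m₀ w = 1 := by
  have h := congrArg (fun f : C(Circle, ℂ) => f z) hR1
  simp only [ruelleOp_eq_sum, ContinuousMap.one_apply, mul_one] at h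
  exact_mod_cast h

theorem weight_le_one {N : ℕ} [NeZero N] {W : Circle → ℝ} (hW : ∀ w, 0 ≤ W w)
    (hsum : ∀ z, ∑ w ∈ preim N z, W w = 1) (w : Circle) : W w ≤ 1 := by
  rw [← hsum (w ^ N)]
  exact Finset.single_le_sum (f := W) (fun v _ => hW v) (mem_preim.mpr rfl)

/-- If some preimage carries the full weight `1`, the others carry none. -/
theorem weight_eq_zero_of_ne {N : ℕ} [NeZero N] {W : Circle → ℝ} (hW : ∀ w, 0 ≤ W w)
    (hsum : ∀ z, ∑ w ∈ preim N z, W w = 1) {c w : Circle} (hc : W c = 1) (hne : w ≠ c)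
    (hw : w ^ N = c ^ N) : W w = 0 := by
  classical
  have h := hsum (c ^ N)
  rw [← Finset.add_sum_erase _ _ (mem_preim.mpr rfl : c ∈ preim N (c ^ N)), hc] at h
  have h0 : ∑ v ∈ (preim N (c ^ N)).erase c, W v = 0 := by linarith
  exact (Finset.sum_eq_zero_iff_of_nonneg fun v _ => hW v).mp h0 w
    (Finset.mem_erase.mpr ⟨hne, mem_preim.mpr hw⟩)

theorem sum_weight_mul_of_eq_one {N : ℕ} [NeZero N] {W : Circle → ℝ} (hW : ∀ w, 0 ≤ W w)
    (hsum : ∀ z, ∑ w ∈ preim N z, W w = 1) {c : Circle} (hc : W c = 1) (f : Circle → ℂ) :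
    ∑ w ∈ preim N (c ^ N), (W w : ℂ) * f w = f c := by
  rw [Finset.sum_eq_single_of_mem c (mem_preim.mpr rfl), hc]
  · simp
  · intro w hw hne
    rw [weight_eq_zero_of_ne hW hsum hc hne (mem_preim.mp hw)]
    simp

theorem norm_ruelleOp_apply_le {N : ℕ} [NeZero N] {m₀ : C(Circle, ℂ)}
    (hR1 : ruelleOp N m₀ 1 = 1) (f : C(Circle, ℂ)) : ‖ruelleOp N m₀ f‖ ≤ ‖f‖ := by
  rw [ContinuousMap.norm_le _ (norm_nonneg _)]
  intro z
  rw [ruelleOp_eq_sum]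
  calc ‖∑ w ∈ preim N z, (weight N m₀ w : ℂ) * f w‖
      ≤ ∑ w ∈ preim N z, weight N m₀ w * ‖f‖ := by
        refine (norm_sum_le _ _).trans (Finset.sum_le_sum fun w _ => ?_)
        rw [norm_mul, Complex.norm_real, Real.norm_of_nonneg (weight_nonneg _ _ _)]
        exact mul_le_mul_of_nonneg_left (f.norm_coe_le_norm w) (weight_nonneg _ _ _)
    _ = ‖f‖ := by rw [← Finset.sum_mul, sum_weight hR1, one_mul]

theorem norm_ruelleOp_le {N : ℕ} [NeZero N] {m₀ : C(Circle, ℂ)}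
    (hR1 : ruelleOp N m₀ 1 = 1) : ‖ruelleOp N m₀‖ ≤ 1 :=
  ContinuousLinearMap.opNorm_le_bound _ zero_le_one fun f => by
    simpa using norm_ruelleOp_apply_le hR1 f

theorem mem_eigenspace_ruelleOp_iff {N : ℕ} {m₀ : C(Circle, ℂ)} {lam : ℂ} {f : C(Circle, ℂ)} :
    f ∈ Module.End.eigenspace
      (ruelleOp N m₀ : C(Circle, ℂ) →ₗ[ℂ] C(Circle, ℂ)) lam ↔ ruelleOp N m₀ f = lam • f := by
  rw [Module.End.mem_eigenspace_iff]; rfl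

/-! ### The open unit disk -/

/-- The isometry `f ↦ f(z ^ N)`, a right inverse of `R`. -/
noncomputable def powComp (N : ℕ) : C(Circle, ℂ) →L[ℂ] C(Circle, ℂ) :=
  ContinuousLinearMap.mk (ContinuousMap.compRightAlgHom ℂ ℂ
    (⟨fun z => z ^ N, by fun_prop⟩ : C(Circle, Circle))).toLinearMap
    (ContinuousMap.continuous_precomp _)

@[simp] theorem powComp_apply (N : ℕ) (f : C(Circle, ℂ)) (z : Circle) :
    powComp N f z = f (z ^ N) := rfl

theorem norm_powComp_le (N : ℕ) : ‖powComp N‖ ≤ 1 :=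
  ContinuousLinearMap.opNorm_le_bound _ zero_le_one fun f => by
    rw [ContinuousMap.norm_le _ (by positivity), one_mul]
    exact fun z => f.norm_coe_le_norm _

theorem ruelleOp_powComp_mul {N : ℕ} [NeZero N] (m₀ b h : C(Circle, ℂ)) :
    ruelleOp N m₀ (powComp N b * h) = b * ruelleOp N m₀ h := by
  ext z
  rw [ContinuousMap.mul_apply, ruelleOp_eq_sum, ruelleOp_eq_sum, Finset.mul_sum]
  refine Finset.sum_congr rfl fun w hw => ?_
  rw [ContinuousMap.mul_apply, powComp_apply, mem_preim.mp hw]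
  ring

theorem ruelleOp_powComp {N : ℕ} [NeZero N] {m₀ : C(Circle, ℂ)} (hR1 : ruelleOp N m₀ 1 = 1)
    (b : C(Circle, ℂ)) : ruelleOp N m₀ (powComp N b) = b := by
  have h := ruelleOp_powComp_mul (N := N) m₀ b 1
  rwa [mul_one, hR1, mul_one] at h

theorem exists_pow_eq_one_ne_one {N : ℕ} (hN : 2 ≤ N) : ∃ ω : Circle, ω ≠ 1 ∧ ω ^ N = 1 := by
  have hN' : (N : ℝ) ≠ 0 := Nat.cast_ne_zero.mpr (by omega)
  refine ⟨Circle.exp (2 * Real.pi / N), ?_, ?_⟩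
  · intro h
    rw [← Circle.exp_zero, Circle.exp_eq_exp] at h
    obtain ⟨m, hm⟩ := h
    have h2 : (1 : ℝ) = m * N := by
      have := Real.pi_pos
      field_simp at hm
      nlinarith
    have h3 : (1 : ℤ) = m * N := by exact_mod_cast h2
    have := Int.eq_one_of_dvd_one (by positivity : (0:ℤ) ≤ N) ⟨m, by linarith⟩
    omega
  · rw [← Circle.exp_natCast_mul, mul_div_cancel₀ _ hN', Circle.exp_two_pi]

/-- A nonzero element of the kernel of `R`: for an `N`-th root of unity `ω ≠ 1`, the
function `W(ωw) β(w) - W(ω⁻¹w) β(ω⁻¹w)` is annihilated by `R` for each `β`. -/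
theorem exists_ruelleOp_eq_zero {N : ℕ} [NeZero N] (hN : 2 ≤ N) {m₀ : C(Circle, ℂ)}
    (h1 : weight N m₀ 1 = 1) : ∃ h : C(Circle, ℂ), h ≠ 0 ∧ ruelleOp N m₀ h = 0 := by
  obtain ⟨ω, hω1, hωN⟩ := exists_pow_eq_one_ne_one hN
  have hc : Continuous (weight N m₀) := by unfold weight; fun_prop
  -- with this `β`, the function is nonzero at `ω⁻¹`: there the first term is `W(1) β(ω⁻¹) ≠ 0` and
  -- the second one vanishes
  set β : Circle → ℂ := fun w => (w : ℂ) - (ω⁻¹ * ω⁻¹ : Circle) with hβ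
  have hβc : Continuous β := by fun_prop
  refine ⟨⟨fun w => (weight N m₀ (ω * w) : ℂ) * β w -
    (weight N m₀ (ω⁻¹ * w) : ℂ) * β (ω⁻¹ * w), by fun_prop⟩, ?_, ?_⟩
  · intro h
    have h' := congrArg (fun f : C(Circle, ℂ) => f ω⁻¹) h
    simp only [ContinuousMap.coe_mk, hβ, mul_inv_cancel, h1, ContinuousMap.zero_apply, sub_self,
      mul_zero, sub_zero, Complex.ofReal_one, one_mul, sub_eq_zero] at h'
    have h2 : ω⁻¹ = ω⁻¹ * ω⁻¹ := Circle.coe_injective h'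
    exact hω1 (by simpa using h2)
  · ext z
    rw [ruelleOp_eq_sum]
    simp only [ContinuousMap.coe_mk, mul_sub, Finset.sum_sub_distrib, ContinuousMap.zero_apply]
    rw [sub_eq_zero]
    refine Finset.sum_bij' (fun w _ => ω * w) (fun w _ => ω⁻¹ * w) ?_ ?_ ?_ ?_ ?_
    · intro w hw; simpa [mul_pow, hωN] using hw
    · intro w hw; simpa [mul_pow, hωN] using hw
    · intro w _; simp
    · intro w _; simp
    · intro w _; simp; ring

/-- The kernel of `R` is a module over the functions of `z ^ N`; a nonzero element `h` gives the
family `p(z ^ N) h(z)`, `p` a polynomial, which is infinite-dimensional because `h` does not vanish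
on some infinite set. -/
theorem exists_polynomial_to_ker {N : ℕ} [NeZero N] (hN : 2 ≤ N) {m₀ : C(Circle, ℂ)}
    (h1 : weight N m₀ 1 = 1) : ∃ T : Polynomial ℂ →ₗ[ℂ] C(Circle, ℂ),
      Function.Injective T ∧ ∀ q, ruelleOp N m₀ (T q) = 0 := by
  obtain ⟨h, hh0, hRh⟩ := exists_ruelleOp_eq_zero hN h1
  let ι : C(Circle, ℂ) := ⟨fun z => (z : ℂ), by fun_prop⟩
  let T : Polynomial ℂ →ₗ[ℂ] C(Circle, ℂ) :=
    (LinearMap.mulRight ℂ h) ∘ₗ (powComp N : C(Circle, ℂ) →ₗ[ℂ] C(Circle, ℂ)) ∘ₗ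
      (Polynomial.aeval ι).toLinearMap
  have hT : ∀ q, T q = powComp N (Polynomial.aeval ι q) * h := fun q => rfl
  have hev : ∀ (q : Polynomial ℂ) (z : Circle), Polynomial.aeval ι q z = q.eval (z : ℂ) := by
    intro q z
    exact (Polynomial.aeval_algHom_apply (ContinuousMap.evalAlgHom ℂ ℂ z) ι q).symm.trans
      (Polynomial.coe_aeval_eq_eval (z : ℂ) ▸ rfl)
  refine ⟨T, (injective_iff_map_eq_zero T).mpr fun q hq => ?_, fun q => ?_⟩
  · obtain ⟨w, hw⟩ : ∃ w, h w ≠ 0 := by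
      by_contra! hcon
      exact hh0 (ContinuousMap.ext hcon)
    obtain ⟨x, rfl⟩ := Circle.exp_surjective w
    -- `h` does not vanish on an arc around `e^{ix}`, hence `q` vanishes on the `N`-th powers
    have hev' : ∀ᶠ y in nhds x, h (Circle.exp y) ≠ 0 := by
      have : Continuous fun y => h (Circle.exp y) := by fun_prop
      exact this.continuousAt.eventually_ne hw
    have hq0 : ∀ᶠ y in nhds x, q.eval ((Circle.exp (N * y) : Circle) : ℂ) = 0 := by
      filter_upwards [hev'] with y hy
      have h2 := congrArg (fun f : C(Circle, ℂ) => f (Circle.exp y)) hq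
      simp only [hT, ContinuousMap.mul_apply, powComp_apply, hev, ContinuousMap.zero_apply,
        mul_eq_zero, hy, or_false, ← Circle.exp_natCast_mul] at h2
      exact h2
    obtain ⟨ε, hε, hball⟩ := Metric.eventually_nhds_iff.mp hq0
    have hN0 : (0 : ℝ) < N := by exact_mod_cast NeZero.pos N
    refine Polynomial.eq_zero_of_infinite_isRoot q
      (Set.Infinite.mono (s := (fun y : ℝ => ((Circle.exp (N * y) : Circle) : ℂ)) ''
        Set.Ioo x (x + min ε (1 / N))) ?_ ?_)
    · rintro _ ⟨y, hy, rfl⟩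
      refine hball ?_
      rw [Real.dist_eq, abs_lt]
      have := min_le_left ε (1 / (N : ℝ))
      constructor <;> linarith [hy.1, hy.2]
    · refine (Set.Ioo_infinite (by
        have : 0 < min ε (1 / (N : ℝ)) := by positivity
        linarith)).image ?_
      intro a ha b hb hab
      obtain ⟨m, hm⟩ := Circle.exp_eq_exp.mp (Circle.coe_injective hab)
      have h3 : |a - b| < 1 / N := by
        have := min_le_right ε (1 / (N : ℝ))
        rw [abs_lt]; constructor <;> linarith [ha.1, ha.2, hb.1, hb.2]
      have h4 : (N : ℝ) * (a - b) = m * (2 * Real.pi) := by linarith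
      have h5 : |(m : ℝ)| * (2 * Real.pi) < 1 := by
        have : |(m : ℝ)| * (2 * Real.pi) = N * |a - b| := by
          rw [← abs_of_pos hN0, ← abs_mul, h4, abs_mul, abs_of_pos Real.two_pi_pos]
        rw [this]
        calc (N : ℝ) * |a - b| < N * (1 / N) := by gcongr
          _ = 1 := by field_simp
      have h6 : m = 0 := by
        by_contra hm0
        have : (1 : ℝ) ≤ |(m : ℝ)| := by exact_mod_cast Int.one_le_abs hm0
        nlinarith [Real.pi_gt_three]
      rw [h6] at h4
      have : a - b = 0 := by
        simpa [hN0.ne'] using h4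
      linarith
  · rw [hT, ruelleOp_powComp_mul, hRh, mul_zero]

/-- For `|λ| < 1` the map `h ↦ (1 - λ S)⁻¹ h = ∑ λⁿ Sⁿ h`, `S f = f(z ^ N)`, embeds the
infinite-dimensional kernel of `R` into the eigenspace for `λ`. -/
theorem not_finiteDimensional_eigenspace {N : ℕ} [NeZero N] (hN : 2 ≤ N) {m₀ : C(Circle, ℂ)}
    (hR1 : ruelleOp N m₀ 1 = 1) (h1 : weight N m₀ 1 = 1) {lam : ℂ} (hlam : ‖lam‖ < 1) :
    ¬ FiniteDimensional ℂ (Module.End.eigenspace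
      (ruelleOp N m₀ : C(Circle, ℂ) →ₗ[ℂ] C(Circle, ℂ)) lam) := by
  intro hfin
  obtain ⟨T, hT, hRT⟩ := exists_polynomial_to_ker hN h1
  have hnorm : ‖lam • powComp N‖ < 1 := by
    rw [norm_smul]
    calc ‖lam‖ * ‖powComp N‖ ≤ ‖lam‖ * 1 := by gcongr; exact norm_powComp_le N
      _ < 1 := by simpa using hlam
  let u : (C(Circle, ℂ) →L[ℂ] C(Circle, ℂ))ˣ := Units.oneSub (lam • powComp N) hnorm
  have hu : ∀ f : C(Circle, ℂ), (u : C(Circle, ℂ) →L[ℂ] C(Circle, ℂ)) f = f - lam • powComp N f :=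
    fun f => rfl
  have huinv : ∀ f : C(Circle, ℂ), (u : C(Circle, ℂ) →L[ℂ] C(Circle, ℂ))
      (((u⁻¹ : (C(Circle, ℂ) →L[ℂ] C(Circle, ℂ))ˣ) : C(Circle, ℂ) →L[ℂ] C(Circle, ℂ)) f) = f :=
    fun f => congrArg (fun A : C(Circle, ℂ) →L[ℂ] C(Circle, ℂ) => A f) u.mul_inv
  let T' : Polynomial ℂ →ₗ[ℂ] C(Circle, ℂ) :=
    (((u⁻¹ : (C(Circle, ℂ) →L[ℂ] C(Circle, ℂ))ˣ) : C(Circle, ℂ) →L[ℂ] C(Circle, ℂ)) :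
      C(Circle, ℂ) →ₗ[ℂ] C(Circle, ℂ)) ∘ₗ T
  have hT' : ∀ q, (u : C(Circle, ℂ) →L[ℂ] C(Circle, ℂ)) (T' q) = T q := fun q => huinv _
  have hmem : ∀ q, T' q ∈ Module.End.eigenspace
      (ruelleOp N m₀ : C(Circle, ℂ) →ₗ[ℂ] C(Circle, ℂ)) lam := by
    intro q
    rw [mem_eigenspace_ruelleOp_iff]
    have h2 := congrArg (ruelleOp N m₀) (hT' q)
    rw [hu, hRT, map_sub, map_smul, ruelleOp_powComp hR1, sub_eq_zero] at h2
    exact h2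
  have hinj : Function.Injective (T'.codRestrict _ hmem) := by
    intro a b hab
    apply hT
    rw [← hT' a, ← hT' b, show T' a = T' b from congrArg Subtype.val hab]
  have := FiniteDimensional.of_injective _ hinj
  exact Polynomial.not_finite (R := ℂ) this

theorem hasEigenvalue_of_norm_lt_one {N : ℕ} [NeZero N] (hN : 2 ≤ N) {m₀ : C(Circle, ℂ)}
    (hR1 : ruelleOp N m₀ 1 = 1) (h1 : weight N m₀ 1 = 1) {lam : ℂ} (hlam : ‖lam‖ < 1) :
    Module.End.HasEigenvalue (ruelleOp N m₀ : C(Circle, ℂ) →ₗ[ℂ] C(Circle, ℂ)) lam := by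
  intro hbot
  refine not_finiteDimensional_eigenspace hN hR1 h1 hlam ?_
  have : Module.End.eigenspace (ruelleOp N m₀ : C(Circle, ℂ) →ₗ[ℂ] C(Circle, ℂ)) lam = ⊥ := hbot
  rw [this]
  infer_instance

theorem mem_spectrum_of_hasEigenvalue {N : ℕ} {m₀ : C(Circle, ℂ)} {lam : ℂ}
    (h : Module.End.HasEigenvalue (ruelleOp N m₀ : C(Circle, ℂ) →ₗ[ℂ] C(Circle, ℂ)) lam) :
    lam ∈ spectrum ℂ (ruelleOp N m₀) := by
  obtain ⟨f, hf, hf0⟩ := h.exists_hasEigenvector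
  rw [mem_eigenspace_ruelleOp_iff] at hf
  rintro ⟨u, hu⟩
  have h2 : (u : C(Circle, ℂ) →L[ℂ] C(Circle, ℂ)) f = 0 := by
    rw [hu]
    change lam • f - ruelleOp N m₀ f = 0
    rw [hf, sub_self]
  have h3 : ((u⁻¹ : (C(Circle, ℂ) →L[ℂ] C(Circle, ℂ))ˣ) : C(Circle, ℂ) →L[ℂ] C(Circle, ℂ))
      ((u : C(Circle, ℂ) →L[ℂ] C(Circle, ℂ)) f) = f :=
    congrArg (fun A : C(Circle, ℂ) →L[ℂ] C(Circle, ℂ) => A f) u.inv_mul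
  rw [h2, map_zero] at h3
  exact hf0 h3.symm

theorem norm_le_one_of_mem_spectrum {E : Type*} [NormedAddCommGroup E] [NormedSpace ℂ E]
    [CompleteSpace E] {T : E →L[ℂ] E} (hT : ‖T‖ ≤ 1) {lam : ℂ} (h : lam ∈ spectrum ℂ T) :
    ‖lam‖ ≤ 1 := by
  refine (spectrum.norm_le_norm_mul_of_mem h).trans ?_
  calc ‖T‖ * ‖(1 : E →L[ℂ] E)‖ ≤ 1 * 1 :=
        mul_le_mul hT ContinuousLinearMap.norm_id_le (norm_nonneg _) zero_le_one
    _ = 1 := one_mul 1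

theorem isClosed_spectrum_clm {E : Type*} [NormedAddCommGroup E] [NormedSpace ℂ E]
    [CompleteSpace E] (T : E →L[ℂ] E) : IsClosed (spectrum ℂ T) :=
  spectrum.isClosed T

theorem spectrum_ruelleOp {N : ℕ} [NeZero N] (hN : 2 ≤ N) {m₀ : C(Circle, ℂ)}
    (hR1 : ruelleOp N m₀ 1 = 1) (h1 : weight N m₀ 1 = 1) :
    spectrum ℂ (ruelleOp N m₀) = {lam : ℂ | ‖lam‖ ≤ 1} := by
  apply Set.Subset.antisymm
  · intro lam hlam
    exact norm_le_one_of_mem_spectrum (norm_ruelleOp_le hR1) hlam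
  · have hcl : IsClosed (spectrum ℂ (ruelleOp N m₀)) := isClosed_spectrum_clm _
    have h2 : Metric.closedBall (0 : ℂ) 1 ⊆ spectrum ℂ (ruelleOp N m₀) := by
      rw [← closure_ball (0 : ℂ) one_ne_zero]
      refine closure_minimal (fun lam hlam => ?_) hcl
      exact mem_spectrum_of_hasEigenvalue
        (hasEigenvalue_of_norm_lt_one hN hR1 h1 (by simpa using hlam))
    intro lam hlam
    exact h2 (by simpa using hlam)

theorem spectralRadius_ruelleOp {N : ℕ} [NeZero N] (hN : 2 ≤ N) {m₀ : C(Circle, ℂ)}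
    (hR1 : ruelleOp N m₀ 1 = 1) (h1 : weight N m₀ 1 = 1) :
    spectralRadius ℂ (ruelleOp N m₀) = 1 := by
  rw [spectralRadius, spectrum_ruelleOp hN hR1 h1]
  refine le_antisymm (iSup₂_le fun lam hlam => ?_) ?_
  · have : ‖lam‖₊ ≤ 1 := hlam
    exact_mod_cast this
  · exact le_iSup₂_of_le (1 : ℂ) (by simp) (by simp)

/-! ### Closed sets that are invariant under backward steps -/

/-- `c` lies on a cycle of `w ↦ w ^ N` all of whose points have weight `1`. -/
def IsCyclePt (N : ℕ) (W : Circle → ℝ) (c : Circle) : Prop :=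
  ∃ p, 0 < p ∧ c ^ N ^ p = c ∧ ∀ j < p, W (c ^ N ^ j) = 1

theorem pow_pow_mul_of_periodic {N n : ℕ} {z : Circle} (hz : z ^ N ^ n = z) (m : ℕ) :
    z ^ N ^ (n * m) = z := by
  induction m with
  | zero => simp
  | succ m ih => rw [Nat.mul_succ, pow_add, pow_mul, ih, hz]

/-- A point has at most one periodic preimage. -/
theorem eq_of_periodic_of_pow_eq {N a b : ℕ} {v w : Circle} (ha : 0 < a) (hb : 0 < b)
    (hv : v ^ N ^ a = v) (hw : w ^ N ^ b = w) (h : v ^ N = w ^ N) : v = w := by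
  have hv' := pow_pow_mul_of_periodic hv b
  have hw' := pow_pow_mul_of_periodic hw a
  rw [mul_comm b a] at hw'
  obtain ⟨q, hq⟩ : ∃ q, a * b = q + 1 := ⟨a * b - 1, (Nat.sub_add_cancel (Nat.mul_pos ha hb)).symm⟩
  rw [hq, pow_succ', pow_mul] at hv' hw'
  rw [← hv', ← hw', h]

theorem exists_preim_ne_zero {N : ℕ} [NeZero N] {W : Circle → ℝ}
    (hsum : ∀ z, ∑ w ∈ preim N z, W w = 1) (z : Circle) : ∃ w, w ^ N = z ∧ W w ≠ 0 := by
  by_contra! h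
  have := hsum z
  rw [Finset.sum_eq_zero fun w hw => h w (mem_preim.mp hw)] at this
  exact zero_ne_one this

/-- If a backward invariant set contains a non-periodic point, its closure contains `1`: far
back in the backward tree of that point there are no more zeros of the weight, so that the
invariant set contains the entire backward orbit `e^{iθ / Nⁿ}` of some `e^{iθ}`. -/
theorem one_mem_of_not_periodic {N : ℕ} [NeZero N] (hN : 2 ≤ N) {W : Circle → ℝ}
    (hsum : ∀ z, ∑ w ∈ preim N z, W w = 1) (hZ : {w | W w = 0}.Finite)
    {F : Set Circle} (hF : IsClosed F) (hinv : ∀ w, w ^ N ∈ F → W w ≠ 0 → w ∈ F)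
    {z : Circle} (hz : z ∈ F) (hper : ∀ n, 0 < n → z ^ N ^ n ≠ z) : (1 : Circle) ∈ F := by
  -- each zero of the weight occurs on at most one level of the backward tree of `z`
  have hfin : {n : ℕ | ∃ w, W w = 0 ∧ w ^ N ^ n = z}.Finite := by
    have : {n : ℕ | ∃ w, W w = 0 ∧ w ^ N ^ n = z} = ⋃ w ∈ {w | W w = 0}, {n | w ^ N ^ n = z} := by
      ext n; simp
    rw [this]
    refine hZ.biUnion fun w _ => Set.Subsingleton.finite fun a ha b hb => ?_
    have key : ∀ a b : ℕ, a < b → w ^ N ^ a = z → w ^ N ^ b = z → False := by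
      intro a b hab ha hb
      refine hper (b - a) (by omega) ?_
      rw [← ha, ← pow_mul, ← pow_add, Nat.add_sub_cancel' hab.le, hb, ha]
    rcases lt_trichotomy a b with h | h | h
    · exact (key a b h ha hb).elim
    · exact h
    · exact (key b a h hb ha).elim
  obtain ⟨M, hM⟩ := hfin.bddAbove
  have hpath : ∀ n, ∃ v ∈ F, v ^ N ^ n = z := by
    intro n
    induction n with
    | zero => exact ⟨z, hz, by simp⟩
    | succ n ih =>
      obtain ⟨v, hv, hvz⟩ := ih
      obtain ⟨w, hwv, hw⟩ := exists_preim_ne_zero hsum v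
      exact ⟨w, hinv w (hwv ▸ hv) hw, by rw [pow_succ', pow_mul, hwv, hvz]⟩
  obtain ⟨v, hv, hvz⟩ := hpath (M + 1)
  have htree : ∀ n w, w ^ N ^ n = v → w ∈ F := by
    intro n
    induction n with
    | zero => intro w hw; rw [pow_zero, pow_one] at hw; exact hw ▸ hv
    | succ n ih =>
      intro w hw
      refine hinv w (ih _ (by rw [← pow_mul, ← pow_succ', hw])) fun h0 => ?_
      have := hM (show (n + 1 + (M + 1)) ∈ _ from ⟨w, h0, by rw [pow_add, pow_mul, hw, hvz]⟩)
      omega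
  obtain ⟨θ, rfl⟩ := Circle.exp_surjective v
  have hlim : Filter.Tendsto (fun n : ℕ => Circle.exp (θ / (N : ℝ) ^ n)) Filter.atTop
      (nhds (Circle.exp 0)) := by
    refine (Circle.exp.continuous.tendsto 0).comp ?_
    exact tendsto_const_nhds.div_atTop
      (tendsto_pow_atTop_atTop_of_one_lt (by exact_mod_cast hN))
  rw [Circle.exp_zero] at hlim
  refine hF.mem_of_tendsto hlim (Filter.Eventually.of_forall fun n => htree n _ ?_)
  have hN' : (N : ℝ) ≠ 0 := Nat.cast_ne_zero.mpr (NeZero.ne N)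
  rw [← Circle.exp_natCast_mul]
  congr 1
  push_cast
  field_simp

/-- If all points of a backward invariant set are periodic, they lie on cycles of weight `1`:
a preimage of nonzero weight is in the set, so it is the unique periodic preimage. -/
theorem isCyclePt_of_forall_periodic {N : ℕ} [NeZero N] {W : Circle → ℝ}
    (hsum : ∀ z, ∑ w ∈ preim N z, W w = 1)
    {F : Set Circle} (hinv : ∀ w, w ^ N ∈ F → W w ≠ 0 → w ∈ F)
    (hper : ∀ z ∈ F, ∃ n, 0 < n ∧ z ^ N ^ n = z) {z : Circle} (hz : z ∈ F) :
    IsCyclePt N W z := by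
  obtain ⟨p, hp, hzp⟩ := hper z hz
  have hstep : ∀ y, y ∈ F → ∀ v b, 0 < b → v ^ N ^ b = v → v ^ N = y → v ∈ F ∧ W v = 1 := by
    intro y hy v b hb hv hvy
    have huniq : ∀ w ∈ preim N y, w ≠ v → W w = 0 := by
      intro w hw hne
      by_contra h0
      rw [mem_preim] at hw
      obtain ⟨a, ha, hwa⟩ := hper w (hinv w (hw ▸ hy) h0)
      exact hne (eq_of_periodic_of_pow_eq ha hb hwa hv (hw.trans hvy.symm))
    have h1 : W v = 1 := by
      rw [← hsum y, Finset.sum_eq_single_of_mem v (mem_preim.mpr hvy) huniq]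
    exact ⟨hinv v (hvy ▸ hy) (by rw [h1]; exact one_ne_zero), h1⟩
  have hdown : ∀ j, j ≤ p → z ^ N ^ (p - j) ∈ F := by
    intro j
    induction j with
    | zero => intro _; rw [Nat.sub_zero, hzp]; exact hz
    | succ j ih =>
      intro hj
      refine (hstep _ (ih (by omega)) _ p hp ?_ ?_).1
      · rw [← pow_mul, mul_comm, pow_mul, hzp]
      · rw [← pow_mul, ← pow_succ]; congr 2; omega
  refine ⟨p, hp, hzp, fun j hj => ?_⟩
  have h2 := hdown (p - (j + 1)) (by omega)
  rw [show p - (p - (j + 1)) = j + 1 by omega] at h2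
  refine (hstep _ h2 _ p hp ?_ ?_).2
  · rw [← pow_mul, mul_comm, pow_mul, hzp]
  · rw [← pow_mul, ← pow_succ]

theorem isCyclePt_one {N : ℕ} {W : Circle → ℝ} (h1 : W 1 = 1) : IsCyclePt N W 1 :=
  ⟨1, one_pos, by simp, by simp [h1]⟩

/-- A nonempty closed set of points which contains, with each point, its preimages of nonzero
weight meets a cycle of weight `1`. This is what makes the maximum principle work. -/
theorem exists_isCyclePt_of_isClosed {N : ℕ} [NeZero N] (hN : 2 ≤ N) {W : Circle → ℝ}
    (hsum : ∀ z, ∑ w ∈ preim N z, W w = 1) (hZ : {w | W w = 0}.Finite) (h1 : W 1 = 1)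
    {F : Set Circle} (hF : IsClosed F) (hne : F.Nonempty)
    (hinv : ∀ w, w ^ N ∈ F → W w ≠ 0 → w ∈ F) : ∃ c ∈ F, IsCyclePt N W c := by
  by_cases h : ∃ z ∈ F, ∀ n, 0 < n → z ^ N ^ n ≠ z
  · obtain ⟨z, hz, hper⟩ := h
    exact ⟨1, one_mem_of_not_periodic hN hsum hZ hF hinv hz hper, isCyclePt_one h1⟩
  · push Not at h
    obtain ⟨z, hz⟩ := hne
    exact ⟨z, hz, isCyclePt_of_forall_periodic hsum hinv h hz⟩

/-- Maximum principle: a function with `R f = λ f`, `|λ| = 1`, that vanishes on the cycles of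
weight `1` is zero. -/
theorem eq_zero_of_forall_isCyclePt {N : ℕ} [NeZero N] (hN : 2 ≤ N) {m₀ : C(Circle, ℂ)}
    (hzeros : {z : Circle | m₀ z = 0}.Finite) (hR1 : ruelleOp N m₀ 1 = 1)
    (h1 : weight N m₀ 1 = 1) {lam : ℂ} (hlam : ‖lam‖ = 1) {f : C(Circle, ℂ)}
    (hf : ruelleOp N m₀ f = lam • f) (h0 : ∀ c, IsCyclePt N (weight N m₀) c → f c = 0) :
    f = 0 := by
  obtain ⟨z₀, -, hz₀⟩ := isCompact_univ.exists_isMaxOn (Set.univ_nonempty (α := Circle))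
    (f := fun z => ‖f z‖) (by fun_prop)
  have hmax : ∀ w, ‖f w‖ ≤ ‖f z₀‖ := fun w => hz₀ (Set.mem_univ w)
  have hinv : ∀ w, w ^ N ∈ {z | ‖f z‖ = ‖f z₀‖} → weight N m₀ w ≠ 0 →
      w ∈ {z | ‖f z‖ = ‖f z₀‖} := by
    intro w hw hw0
    by_contra hlt
    have hlt' : ‖f w‖ < ‖f z₀‖ := lt_of_le_of_ne (hmax w) hlt
    have h2 : ‖ruelleOp N m₀ f (w ^ N)‖ = ‖f z₀‖ := by
      rw [hf, ContinuousMap.smul_apply, norm_smul, hlam, one_mul]; exact hw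
    have h3 : ‖ruelleOp N m₀ f (w ^ N)‖ < ‖f z₀‖ := by
      rw [ruelleOp_eq_sum]
      calc _ ≤ ∑ v ∈ preim N (w ^ N), weight N m₀ v * ‖f v‖ := by
            refine (norm_sum_le _ _).trans (Finset.sum_le_sum fun v _ => ?_)
            rw [norm_mul, Complex.norm_real, Real.norm_of_nonneg (weight_nonneg _ _ _)]
        _ < ∑ v ∈ preim N (w ^ N), weight N m₀ v * ‖f z₀‖ := by
            refine Finset.sum_lt_sum (fun v _ =>
              mul_le_mul_of_nonneg_left (hmax v) (weight_nonneg _ _ _))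
              ⟨w, mem_preim.mpr rfl, ?_⟩
            exact mul_lt_mul_of_pos_left hlt'
              (lt_of_le_of_ne (weight_nonneg _ _ _) (Ne.symm hw0))
        _ = ‖f z₀‖ := by rw [← Finset.sum_mul, sum_weight hR1, one_mul]
    exact absurd h2 h3.ne
  obtain ⟨c, hcF, hc⟩ := exists_isCyclePt_of_isClosed hN (sum_weight hR1)
    (W := weight N m₀) (by simpa only [weight_eq_zero] using hzeros) h1
    (F := {z | ‖f z‖ = ‖f z₀‖}) (isClosed_eq (by fun_prop) continuous_const) ⟨z₀, rfl⟩ hinv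
  have hcF' : ‖f c‖ = ‖f z₀‖ := hcF
  rw [h0 c hc, norm_zero] at hcF'
  ext w
  have := hmax w
  rw [← hcF'] at this
  simpa using this

/-! ### Cycles -/

theorem IsCycle.pow_eq {N p : ℕ} {z : Fin p → Circle} (hz : IsCycle N z) (j : ℕ) (k : Fin p) :
    z k ^ N ^ j = z ((finRotate p ^ j) k) := by
  induction j with
  | zero => simp
  | succ j ih => rw [pow_succ, pow_mul, ih, hz.2.2, pow_succ', Equiv.Perm.mul_apply]

theorem finRotate_pow_self (p : ℕ) : finRotate p ^ p = 1 := by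
  rcases Nat.lt_or_ge p 2 with h | h
  · ext k
    have := Fin.subsingleton_iff_le_one.mpr (by omega : p ≤ 1)
    rw [Subsingleton.elim ((finRotate p ^ p) k) k]; rfl
  · obtain ⟨n, rfl⟩ := Nat.exists_eq_add_of_le' h
    have h2 := pow_orderOf_eq_one (finRotate (n + 2))
    rwa [isCycle_finRotate.orderOf, support_finRotate, Finset.card_univ, Fintype.card_fin] at h2

theorem IsMCycle.weight_eq_one {N p : ℕ} [NeZero N] {m₀ : Circle → ℂ} {z : Fin p → Circle}
    (hz : IsMCycle N m₀ z) (k : Fin p) : weight N m₀ (z k) = 1 :=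
  Galerkin.weight_eq_one.mpr (hz.2 k)

/-- Every point on a cycle of weight `1` belongs to the range of some `m₀`-cycle. -/
theorem IsCyclePt.exists_isMCycle {N : ℕ} [NeZero N] {m₀ : Circle → ℂ} {c : Circle}
    (hc : IsCyclePt N (weight N m₀) c) :
    ∃ (p : ℕ) (z : Fin p → Circle), IsMCycle N m₀ z ∧ c ∈ Set.range z := by
  obtain ⟨q, hq, hcq, hW⟩ := hc
  have hit : ∀ j, (fun w : Circle => w ^ N)^[j] c = c ^ N ^ j := fun j => by
    simp [pow_iterate]
  have hper : Function.IsPeriodicPt (fun w : Circle => w ^ N) q c := by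
    rw [Function.IsPeriodicPt, Function.IsFixedPt, hit, hcq]
  set p := Function.minimalPeriod (fun w : Circle => w ^ N) c with hp
  have hp0 : 0 < p := hper.minimalPeriod_pos hq
  have hpq : p ≤ q := hper.minimalPeriod_le hq
  have hcp : c ^ N ^ p = c := by
    rw [← hit]; exact Function.iterate_minimalPeriod
  refine ⟨p, fun k => c ^ N ^ (k : ℕ), ⟨⟨hp0, ?_, ?_⟩, ?_⟩, ⟨⟨0, hp0⟩, by simp⟩⟩
  · intro a b hab
    have := Function.iterate_injOn_Iio_minimalPeriod (f := fun w : Circle => w ^ N) (x := c)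
      (show (a : ℕ) ∈ Set.Iio _ from a.2) (show (b : ℕ) ∈ Set.Iio _ from b.2)
      (by simpa only [hit] using hab)
    exact Fin.ext this
  · intro k
    simp only
    rw [← pow_mul, ← pow_succ]
    have hk := k.2
    clear_value p
    obtain ⟨n, rfl⟩ := Nat.exists_eq_succ_of_ne_zero hp0.ne'
    rcases Nat.lt_or_ge (k : ℕ) n with h | h
    · rw [coe_finRotate_of_ne_last (by rw [Ne, Fin.ext_iff, Fin.val_last]; omega)]
    · have hk' : k = Fin.last n := by rw [Fin.ext_iff, Fin.val_last]; omega
      rw [hk', finRotate_last]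
      simpa using hcp
  · intro k
    exact weight_eq_one.mp (hW k (by omega))

/-- The points of weight `1` are finite in number: multiplication by an `N`-th root of unity
other than `1` moves them to zeros of the weight. -/
theorem finite_setOf_weight_eq_one {N : ℕ} [NeZero N] (hN : 2 ≤ N) {W : Circle → ℝ}
    (hW : ∀ w, 0 ≤ W w) (hsum : ∀ z, ∑ w ∈ preim N z, W w = 1) (hZ : {w | W w = 0}.Finite) :
    {w | W w = 1}.Finite := by
  obtain ⟨ω, hω1, hωN⟩ := exists_pow_eq_one_ne_one hN
  refine (hZ.preimage (f := fun w => ω * w) (mul_right_injective ω).injOn).subset fun w hw => ?_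
  exact weight_eq_zero_of_ne hW hsum hw (by simpa using hω1) (by rw [mul_pow, hωN, one_mul])

theorem finite_mCycles {N : ℕ} [NeZero N] (hN : 2 ≤ N) {m₀ : C(Circle, ℂ)}
    (hzeros : {z : Circle | m₀ z = 0}.Finite) (hR1 : ruelleOp N m₀ 1 = 1) :
    (mCycles N m₀).Finite := by
  refine (finite_setOf_weight_eq_one hN (weight_nonneg N m₀) (sum_weight hR1)
    (by simpa only [weight_eq_zero] using hzeros)).finite_subsets.subset ?_
  rintro _ ⟨p, z, hz, rfl⟩ _ ⟨k, rfl⟩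
  exact hz.weight_eq_one k

/-! ### Regularity of the peripheral eigenfunctions -/

theorem dist_circle_eq (t s : Circle) : dist t s = ‖(t : ℂ) - s‖ := by
  rw [← dist_eq_norm]; rfl

theorem dist_circle_exp_le (x y : ℝ) : dist (Circle.exp x) (Circle.exp y) ≤ |x - y| := by
  have h1 : (Circle.exp x : ℂ) - Circle.exp y =
      Circle.exp y * (Complex.exp (Complex.I * (x - y : ℝ)) - 1) := by
    rw [mul_sub, mul_one, Circle.coe_exp, Circle.coe_exp, ← Complex.exp_add]
    congr 2
    push_cast
    ring
  rw [dist_circle_eq, h1, norm_mul, Circle.norm_coe, one_mul]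
  exact Real.norm_exp_I_mul_ofReal_sub_one_le

theorem exists_exp_eq_dist_le (t s : Circle) :
    ∃ x y : ℝ, Circle.exp x = t ∧ Circle.exp y = s ∧ |x - y| ≤ Real.pi / 2 * dist t s := by
  refine ⟨Complex.arg s + Complex.arg (t / s : Circle), Complex.arg s, ?_, Circle.exp_arg s, ?_⟩
  · rw [Circle.exp_add, Circle.exp_arg, Circle.exp_arg, mul_div_cancel]
  · have h := Complex.angle_le_mul_norm_sub (Circle.norm_coe t) (Circle.norm_coe s)
    rw [Complex.angle_eq_abs_arg (Circle.coe_ne_zero t) (Circle.coe_ne_zero s)] at h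
    rw [add_sub_cancel_left, Circle.coe_div, dist_circle_eq]
    exact h

theorem exists_lipschitzWith_of_exp {f : Circle → ℂ} {K : ℝ}
    (h : ∀ x y, ‖f (Circle.exp x) - f (Circle.exp y)‖ ≤ K * |x - y|) :
    ∃ K', LipschitzWith K' f := by
  have hK : 0 ≤ K := by simpa using (norm_nonneg _).trans (h 1 0)
  refine ⟨⟨K * (Real.pi / 2), by positivity⟩, LipschitzWith.of_dist_le_mul fun t s => ?_⟩
  obtain ⟨x, y, rfl, rfl, hxy⟩ := exists_exp_eq_dist_le t s
  rw [dist_eq_norm]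
  refine (h x y).trans ?_
  change _ ≤ K * (Real.pi / 2) * dist _ _
  rw [mul_assoc]
  gcongr

theorem exists_weight_exp_lipschitz (N : ℕ) {m₀ : C(Circle, ℂ)} (hLip : ∃ K, LipschitzWith K m₀) :
    ∃ L : ℝ, 0 ≤ L ∧ ∀ (c : Circle) (x y : ℝ), |weight N m₀ (c * Circle.exp x) -
      weight N m₀ (c * Circle.exp y)| ≤ L * |x - y| := by
  obtain ⟨K, hK⟩ := hLip
  refine ⟨2 * ‖m₀‖ / N * K, by positivity, fun c x y => ?_⟩
  obtain ⟨a, rfl⟩ := Circle.exp_surjective c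
  rw [← Circle.exp_add, ← Circle.exp_add]
  set v := Circle.exp (a + x)
  set w := Circle.exp (a + y)
  have h1 : weight N m₀ v - weight N m₀ w = (‖m₀ v‖ + ‖m₀ w‖) / N * (‖m₀ v‖ - ‖m₀ w‖) := by
    unfold weight; ring
  have h2 : |‖m₀ v‖ - ‖m₀ w‖| ≤ K * |x - y| := by
    refine (abs_norm_sub_norm_le _ _).trans ?_
    rw [← dist_eq_norm]
    refine (hK.dist_le_mul v w).trans ?_
    have := dist_circle_exp_le (a + x) (a + y)
    rw [add_sub_add_left_eq_sub] at this
    gcongr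
  rw [h1, abs_mul, abs_of_nonneg (by positivity), mul_assoc]
  refine mul_le_mul ?_ h2 (abs_nonneg _) (by positivity)
  have := m₀.norm_coe_le_norm v
  have := m₀.norm_coe_le_norm w
  gcongr
  linarith

/-- One application of `R` contracts distances by `N`: a modulus of continuity `ε + K δ` valid at
distances `≤ δ` is valid at distances `≤ N δ`, provided that `K` is large enough. -/
theorem norm_sub_le_of_ruelleOp {N : ℕ} [NeZero N] (hN : 2 ≤ N) {m₀ : C(Circle, ℂ)}
    (hR1 : ruelleOp N m₀ 1 = 1) {L : ℝ} (hL : ∀ (c : Circle) (x y : ℝ),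
      |weight N m₀ (c * Circle.exp x) - weight N m₀ (c * Circle.exp y)| ≤ L * |x - y|)
    {lam : ℂ} (hlam : ‖lam‖ = 1) {f : C(Circle, ℂ)} (hf : ruelleOp N m₀ f = lam • f) {ε δ : ℝ}
    (h : ∀ x y, |x - y| ≤ δ →
      ‖f (Circle.exp x) - f (Circle.exp y)‖ ≤ ε + 2 * L * ‖f‖ * |x - y|) :
    ∀ x y, |x - y| ≤ N * δ →
      ‖f (Circle.exp x) - f (Circle.exp y)‖ ≤ ε + 2 * L * ‖f‖ * |x - y| := by
  intro x y hxy
  have hN0 : (0 : ℝ) < N := by exact_mod_cast NeZero.pos N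
  have hN2 : (2 : ℝ) ≤ N := by exact_mod_cast hN
  have hLf : 0 ≤ L * ‖f‖ := by
    have : 0 ≤ L := by simpa using (abs_nonneg _).trans (hL 1 1 0)
    positivity
  set X : ℕ → ℝ := fun k => (x + 2 * Real.pi * k) / N with hX
  set Y : ℕ → ℝ := fun k => (y + 2 * Real.pi * k) / N with hY
  have hXY : ∀ k, |X k - Y k| = |x - y| / N := by
    intro k
    rw [hX, hY, ← sub_div, add_sub_add_right_eq_sub, abs_div, abs_of_pos hN0]
  have hval : ∀ x : ℝ, lam * f (Circle.exp x) = ∑ k ∈ Finset.range N,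
      (weight N m₀ (Circle.exp ((x + 2 * Real.pi * k) / N)) : ℂ) *
        f (Circle.exp ((x + 2 * Real.pi * k) / N)) := by
    intro x
    rw [← sum_preim_exp (fun w => (weight N m₀ w : ℂ) * f w), ← ruelleOp_eq_sum, hf]
    rfl
  have h1 : ‖f (Circle.exp x) - f (Circle.exp y)‖ =
      ‖lam * f (Circle.exp x) - lam * f (Circle.exp y)‖ := by
    rw [← mul_sub, norm_mul, hlam, one_mul]
  have hw1 : ∑ k ∈ Finset.range N, weight N m₀ (Circle.exp (X k)) = 1 := by
    rw [← sum_preim_exp_real, sum_weight hR1]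
  rw [h1, hval, hval, ← Finset.sum_sub_distrib]
  calc ‖∑ k ∈ Finset.range N, ((weight N m₀ (Circle.exp (X k)) : ℂ) * f (Circle.exp (X k)) -
          (weight N m₀ (Circle.exp (Y k)) : ℂ) * f (Circle.exp (Y k)))‖
      ≤ ∑ k ∈ Finset.range N, (weight N m₀ (Circle.exp (X k)) *
          (ε + 2 * L * ‖f‖ * (|x - y| / N)) + L * (|x - y| / N) * ‖f‖) := by
        refine (norm_sum_le _ _).trans (Finset.sum_le_sum fun k _ => ?_)
        have h3 : (weight N m₀ (Circle.exp (X k)) : ℂ) * f (Circle.exp (X k)) -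
            (weight N m₀ (Circle.exp (Y k)) : ℂ) * f (Circle.exp (Y k)) =
            (weight N m₀ (Circle.exp (X k)) : ℂ) * (f (Circle.exp (X k)) - f (Circle.exp (Y k))) +
            ((weight N m₀ (Circle.exp (X k)) - weight N m₀ (Circle.exp (Y k)) : ℝ) : ℂ) *
              f (Circle.exp (Y k)) := by
          push_cast; ring
        rw [h3]
        refine (norm_add_le _ _).trans (add_le_add ?_ ?_)
        · rw [norm_mul, Complex.norm_real, Real.norm_of_nonneg (weight_nonneg _ _ _)]
          refine mul_le_mul_of_nonneg_left ?_ (weight_nonneg _ _ _)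
          rw [← hXY k]
          refine h _ _ ?_
          rw [hXY, div_le_iff₀ hN0, mul_comm]
          exact hxy
        · rw [norm_mul, Complex.norm_real, Real.norm_eq_abs]
          refine mul_le_mul ?_ (f.norm_coe_le_norm _) (norm_nonneg _) ?_
          · have := hL 1 (X k) (Y k)
            rwa [one_mul, one_mul, hXY] at this
          · have : 0 ≤ L := by simpa using (abs_nonneg _).trans (hL 1 1 0)
            positivity
    _ = ε + 2 * (L * ‖f‖) * |x - y| / N + L * ‖f‖ * |x - y| := by
        rw [Finset.sum_add_distrib, ← Finset.sum_mul, hw1, Finset.sum_const, Finset.card_range,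
          nsmul_eq_mul]
        field_simp
    _ ≤ ε + 2 * L * ‖f‖ * |x - y| := by
        have : 2 * (L * ‖f‖) * |x - y| / N ≤ L * ‖f‖ * |x - y| := by
          rw [div_le_iff₀ hN0]
          nlinarith [mul_nonneg hLf (abs_nonneg (x - y))]
        linarith

/-- Continuous eigenfunctions for eigenvalues of modulus `1` are Lipschitz. -/
theorem exists_lipschitzWith_of_eigen {N : ℕ} [NeZero N] (hN : 2 ≤ N) {m₀ : C(Circle, ℂ)}
    (hLip : ∃ K, LipschitzWith K m₀) (hR1 : ruelleOp N m₀ 1 = 1) {lam : ℂ} (hlam : ‖lam‖ = 1)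
    {f : C(Circle, ℂ)} (hf : ruelleOp N m₀ f = lam • f) : ∃ K, LipschitzWith K f := by
  obtain ⟨L, hL0, hL⟩ := exists_weight_exp_lipschitz N hLip
  refine exists_lipschitzWith_of_exp (K := 2 * L * ‖f‖) fun x y => ?_
  refine le_of_forall_pos_le_add fun ε hε => ?_
  rw [add_comm]
  have huc : UniformContinuous fun x : ℝ => f (Circle.exp x) :=
    (CompactSpace.uniformContinuous_of_continuous f.continuous).comp
      (LipschitzWith.of_dist_le_mul (K := 1) fun x y => by
        simpa [Real.dist_eq] using dist_circle_exp_le x y).uniformContinuous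
  obtain ⟨δ, hδ, hδf⟩ := Metric.uniformContinuous_iff.mp huc ε hε
  have hn : ∀ n : ℕ, ∀ x y, |x - y| ≤ N ^ n * (δ / 2) →
      ‖f (Circle.exp x) - f (Circle.exp y)‖ ≤ ε + 2 * L * ‖f‖ * |x - y| := by
    intro n
    induction n with
    | zero =>
      intro x y hxy
      have h1 : dist x y < δ := by rw [Real.dist_eq]; linarith
      have h2 := hδf h1
      rw [dist_eq_norm] at h2
      have : 0 ≤ 2 * L * ‖f‖ * |x - y| := by positivity
      linarith
    | succ n ih =>
      have := norm_sub_le_of_ruelleOp hN hR1 hL hlam hf ih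
      intro x y hxy
      exact this x y (by rw [pow_succ'] at hxy; linarith)
  have hN1 : (1 : ℝ) < N := by exact_mod_cast hN
  obtain ⟨n, hn'⟩ := pow_unbounded_of_one_lt (|x - y| / (δ / 2)) hN1
  exact hn n x y ((div_lt_iff₀ (by positivity)).mp hn').le

/-! ### Trigonometric polynomials -/

/-- The character `z ↦ z ^ k`. -/
noncomputable def mono (k : ℤ) : C(Circle, ℂ)  where
  toFun z := ((z ^ k : Circle) : ℂ)
  continuous_toFun := (by fun_prop : Continuous fun w : Circle => (w : ℂ)).comp (continuous_zpow k)

theorem mono_apply (k : ℤ) (z : Circle) : mono k z = (z : ℂ) ^ k := Circle.coe_zpow z k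

/-- Trigonometric polynomials of degree at most `D`. -/
noncomputable def trigPoly (D : ℤ) : Submodule ℂ C(Circle, ℂ) :=
  Submodule.span ℂ (mono '' (Finset.Icc (-D) D : Finset ℤ))

theorem isTrigPoly_of_mem {D : ℤ} {f : C(Circle, ℂ)} (hf : f ∈ trigPoly D) : IsTrigPoly f := by
  obtain ⟨a, ha⟩ := (Submodule.mem_span_image_finset_iff_exists_fun' ℂ).mp hf
  refine ⟨Finset.Icc (-D) D, a, fun z => ?_⟩
  rw [← ha, ContinuousMap.sum_apply]
  exact Finset.sum_congr rfl fun k _ => by rw [ContinuousMap.smul_apply, mono_apply, smul_eq_mul]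

theorem mono_mem_trigPoly {D k : ℤ} (h : |k| ≤ D) : mono k ∈ trigPoly D :=
  Submodule.subset_span ⟨k, by simpa [abs_le] using h, rfl⟩

theorem trigPoly_mono {D E : ℤ} (h : D ≤ E) : trigPoly D ≤ trigPoly E := by
  refine Submodule.span_mono (Set.image_mono ?_)
  exact_mod_cast Finset.Icc_subset_Icc (by omega) h

theorem span_mono_topologicalClosure :
    (Submodule.span ℂ (Set.range mono)).topologicalClosure = ⊤ := by
  have : Fact (0 < (1 : ℝ)) := ⟨one_pos⟩
  let e := AddCircle.homeomorphCircle (T := 1) one_ne_zero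
  let Φ : C(AddCircle (1 : ℝ), ℂ) →ₗ[ℂ] C(Circle, ℂ) :=
    (ContinuousMap.compRightAlgHom ℂ ℂ (e.symm : C(Circle, AddCircle (1 : ℝ)))).toLinearMap
  have hΦc : Continuous Φ := ContinuousMap.continuous_precomp _
  have hΦ : ∀ n, Φ (fourier n) = mono n := by
    intro n
    ext z
    change ((AddCircle.toCircle (n • e.symm z) : Circle) : ℂ) = ((z ^ n : Circle) : ℂ)
    rw [AddCircle.toCircle_zsmul]
    have : AddCircle.toCircle (e.symm z) = z := by
      rw [← AddCircle.homeomorphCircle_apply one_ne_zero]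
      exact e.apply_symm_apply z
    rw [this]
  rw [eq_top_iff]
  intro f _
  have hmem : f.comp (e : C(AddCircle (1 : ℝ), Circle)) ∈
      (Submodule.span ℂ (Set.range (fourier (T := 1)))).topologicalClosure := by
    rw [span_fourier_closure_eq_top]; trivial
  have h2 : Φ (f.comp (e : C(AddCircle (1 : ℝ), Circle))) = f := by
    ext z
    exact congrArg f (e.apply_symm_apply z)
  rw [← h2]
  refine map_mem_closure hΦc hmem fun g hg => ?_
  have h3 : Φ g ∈ (Submodule.span ℂ (Set.range (fourier (T := 1)))).map Φ := ⟨g, hg, rfl⟩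
  rw [Submodule.map_span, ← Set.range_comp] at h3
  rwa [show (Φ ∘ fourier : ℤ → C(Circle, ℂ)) = mono from funext hΦ] at h3

theorem exists_mem_trigPoly_of_mem_span {f : C(Circle, ℂ)}
    (hf : f ∈ Submodule.span ℂ (Set.range mono)) : ∃ D : ℕ, f ∈ trigPoly D := by
  induction hf using Submodule.span_induction with
  | mem f h =>
    obtain ⟨k, rfl⟩ := h
    exact ⟨k.natAbs, mono_mem_trigPoly (by simp)⟩
  | zero => exact ⟨0, zero_mem _⟩
  | add f g _ _ hf hg =>
    obtain ⟨D, hD⟩ := hf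
    obtain ⟨E, hE⟩ := hg
    exact ⟨D + E, add_mem (trigPoly_mono (by push_cast; omega) hD)
      (trigPoly_mono (by push_cast; omega) hE)⟩
  | smul c f _ hf =>
    obtain ⟨D, hD⟩ := hf
    exact ⟨D, Submodule.smul_mem _ c hD⟩

/-- Averaging `w ^ q` over the `N`-th roots `w` of `z` gives `z ^ (q / N)` if `N ∣ q`, and `0`
otherwise. -/
theorem sum_preim_zpow (N : ℕ) [NeZero N] (q : ℤ) (z : Circle) :
    (1 / N : ℂ) * ∑ w ∈ preim N z, (w : ℂ) ^ q = if (N : ℤ) ∣ q then (z : ℂ) ^ (q / N) else 0 := by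
  have hN : (N : ℂ) ≠ 0 := Nat.cast_ne_zero.mpr (NeZero.ne N)
  have hNr : (N : ℝ) ≠ 0 := Nat.cast_ne_zero.mpr (NeZero.ne N)
  split_ifs with hq
  · obtain ⟨r, rfl⟩ := hq
    rw [Int.mul_ediv_cancel_left _ (by exact_mod_cast NeZero.ne N)]
    have h1 : ∑ w ∈ preim N z, (w : ℂ) ^ ((N : ℤ) * r) = ∑ w ∈ preim N z, (z : ℂ) ^ r := by
      refine Finset.sum_congr rfl fun w hw => ?_
      rw [← mem_preim.mp hw, zpow_mul, zpow_natCast, Circle.coe_pow]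
    obtain ⟨x, rfl⟩ := Circle.exp_surjective z
    rw [h1, sum_preim_exp (fun _ => ((Circle.exp x : Circle) : ℂ) ^ r), Finset.sum_const,
      Finset.card_range, nsmul_eq_mul]
    field_simp
  · set ω := Circle.exp (2 * Real.pi / N) with hω
    have hωN : ω ^ N = 1 := by
      rw [hω, ← Circle.exp_natCast_mul, mul_div_cancel₀ _ hNr, Circle.exp_two_pi]
    have hωq : (ω : ℂ) ^ q ≠ 1 := by
      intro h
      have h' : ω ^ q = 1 := by
        apply Circle.coe_injective; rw [Circle.coe_zpow, h, Circle.coe_one]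
      rw [hω, ← Circle.exp_intCast_mul, ← Circle.exp_zero, Circle.exp_eq_exp] at h'
      obtain ⟨m, hm⟩ := h'
      have h2 : (q : ℝ) = N * m := by
        have := Real.pi_pos
        field_simp at hm
        nlinarith
      exact hq ⟨m, by exact_mod_cast h2⟩
    have h1 : ∑ w ∈ preim N z, (w : ℂ) ^ q = (ω : ℂ) ^ q * ∑ w ∈ preim N z, (w : ℂ) ^ q := by
      rw [Finset.mul_sum]
      refine Finset.sum_bij' (fun w _ => ω⁻¹ * w) (fun w _ => ω * w) ?_ ?_ ?_ ?_ ?_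
      · intro w hw; simpa [mul_pow, hωN] using hw
      · intro w hw; simpa [mul_pow, hωN] using hw
      · intro w _; simp
      · intro w _; simp
      · intro w _
        rw [← mul_zpow, ← Circle.coe_mul, mul_inv_cancel_left]
    have h2 : (1 - (ω : ℂ) ^ q) * ∑ w ∈ preim N z, (w : ℂ) ^ q = 0 := by linear_combination h1
    rcases mul_eq_zero.mp h2 with h3 | h3
    · exact (hωq (by linear_combination -h3)).elim
    · rw [h3, mul_zero]

/-- If `m₀` is a trigonometric polynomial of degree at most `d`, then `R` lowers the degree of
trigonometric polynomials until it is at most `2 d`. -/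
theorem ruelleOp_mem_trigPoly {N : ℕ} [NeZero N] (hN : 2 ≤ N) {m₀ : C(Circle, ℂ)} {s : Finset ℤ}
    {a : ℤ → ℂ} (hm : ∀ z, m₀ z = ∑ k ∈ s, a k * (z : ℂ) ^ k) {d : ℤ} (hd : ∀ k ∈ s, |k| ≤ d)
    {D : ℤ} {f : C(Circle, ℂ)} (hf : f ∈ trigPoly D) :
    ruelleOp N m₀ f ∈ trigPoly (max (2 * d) (D - 1)) := by
  have hspan : trigPoly D ≤ (trigPoly (max (2 * d) (D - 1))).comap
      (ruelleOp N m₀ : C(Circle, ℂ) →ₗ[ℂ] C(Circle, ℂ)) := by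
    refine Submodule.span_le.mpr ?_
    rintro _ ⟨m, hm', rfl⟩
    have hmD : |m| ≤ D := by simpa [abs_le] using hm'
    have hR : ruelleOp N m₀ (mono m) = ∑ k ∈ s, ∑ l ∈ s, (a k * starRingEnd ℂ (a l)) •
        (if (N : ℤ) ∣ (k - l + m) then mono ((k - l + m) / N) else 0) := by
      ext z
      have hw : ∀ w : Circle, (weight N m₀ w : ℂ) * mono m w = ∑ k ∈ s, ∑ l ∈ s,
          (a k * starRingEnd ℂ (a l)) * ((1 / N : ℂ) * (w : ℂ) ^ (k - l + m)) := by
        intro w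
        have hw0 := Circle.coe_ne_zero w
        have h1 : (weight N m₀ w : ℂ) = (1 / N : ℂ) * (m₀ w * starRingEnd ℂ (m₀ w)) := by
          rw [Complex.mul_conj, Complex.normSq_eq_norm_sq, weight]
          push_cast
          ring
        rw [h1, hm, map_sum, Finset.sum_mul_sum, Finset.mul_sum, Finset.sum_mul, mono_apply]
        refine Finset.sum_congr rfl fun k _ => ?_
        rw [Finset.mul_sum, Finset.sum_mul]
        refine Finset.sum_congr rfl fun l _ => ?_
        rw [map_mul, map_zpow₀, ← Circle.coe_inv_eq_conj, Circle.coe_inv, inv_zpow',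
          zpow_add₀ hw0, sub_eq_add_neg, zpow_add₀ hw0]
        ring
      rw [ruelleOp_eq_sum, Finset.sum_congr rfl fun w _ => hw w, Finset.sum_comm,
        ContinuousMap.sum_apply]
      refine Finset.sum_congr rfl fun k _ => ?_
      rw [Finset.sum_comm, ContinuousMap.sum_apply]
      refine Finset.sum_congr rfl fun l _ => ?_
      rw [← Finset.mul_sum, ← Finset.mul_sum, sum_preim_zpow, ContinuousMap.smul_apply]
      split_ifs <;> simp [mono_apply]
    change ruelleOp N m₀ (mono m) ∈ trigPoly _
    rw [hR]
    refine sum_mem fun k hk => sum_mem fun l hl => Submodule.smul_mem _ _ ?_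
    split_ifs with hdvd
    · obtain ⟨r, hr⟩ := hdvd
      rw [hr, Int.mul_ediv_cancel_left _ (by exact_mod_cast NeZero.ne N)]
      refine mono_mem_trigPoly ?_
      have h1 : |(N : ℤ) * r| ≤ 2 * d + D := by
        rw [← hr]
        have := hd k hk
        have := hd l hl
        rw [abs_le] at *
        constructor <;> linarith
      rw [abs_mul, Nat.abs_cast] at h1
      have h2 : 2 * |r| ≤ (N : ℤ) * |r| :=
        mul_le_mul_of_nonneg_right (by exact_mod_cast hN) (abs_nonneg r)
      omega
    · exact zero_mem _
  exact hspan hf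

/-- Continuous eigenfunctions for eigenvalues of modulus `1` are trigonometric polynomials if `m₀`
is one: approximating `f` by trigonometric polynomials `g`, the functions `λ⁻ⁿ Rⁿ g` approximate
`f` equally well, and for large `n` they lie in a fixed finite-dimensional space. -/
theorem isTrigPoly_of_eigen {N : ℕ} [NeZero N] (hN : 2 ≤ N) {m₀ : C(Circle, ℂ)}
    (hR1 : ruelleOp N m₀ 1 = 1) (hm : IsTrigPoly m₀) {lam : ℂ} (hlam : ‖lam‖ = 1)
    {f : C(Circle, ℂ)} (hf : ruelleOp N m₀ f = lam • f) : IsTrigPoly f := by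
  obtain ⟨s, a, hm⟩ := hm
  obtain ⟨d, hd⟩ : ∃ d : ℤ, ∀ k ∈ s, |k| ≤ d :=
    ⟨∑ k ∈ s, |k|, fun k hk => Finset.single_le_sum (f := fun k : ℤ => |k|)
      (fun _ _ => abs_nonneg _) hk⟩
  have hlam0 : lam ≠ 0 := norm_ne_zero_iff.mp (by rw [hlam]; exact one_ne_zero)
  set R := ruelleOp N m₀ with hR
  have hdeg : ∀ (n : ℕ) (D : ℤ) (g : C(Circle, ℂ)), g ∈ trigPoly D →
      R^[n] g ∈ trigPoly (max (2 * d) (D - n)) := by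
    intro n
    induction n with
    | zero => intro D g hg; exact trigPoly_mono (by simp) hg
    | succ n ih =>
      intro D g hg
      rw [Function.iterate_succ_apply']
      exact trigPoly_mono (by push_cast; omega) (ruelleOp_mem_trigPoly hN hm hd (ih D g hg))
  have hnorm : ∀ (n : ℕ) (g : C(Circle, ℂ)), ‖f - (lam⁻¹) ^ n • R^[n] g‖ ≤ ‖f - g‖ := by
    intro n g
    induction n with
    | zero => simp
    | succ n ih =>
      have h1 : f - (lam⁻¹) ^ (n + 1) • R^[n + 1] g =
          lam⁻¹ • R (f - (lam⁻¹) ^ n • R^[n] g) := by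
        rw [Function.iterate_succ_apply', map_sub, hf, map_smul, smul_sub, smul_smul,
          inv_mul_cancel₀ hlam0, one_smul, smul_smul, pow_succ']
      rw [h1, norm_smul, norm_inv, hlam, inv_one, one_mul]
      exact (norm_ruelleOp_apply_le hR1 _).trans ih
  have : FiniteDimensional ℂ (trigPoly (2 * d)) :=
    FiniteDimensional.span_of_finite ℂ ((Finset.finite_toSet _).image _)
  have hcl : IsClosed (trigPoly (2 * d) : Set C(Circle, ℂ)) :=
    Submodule.closed_of_finiteDimensional _
  refine isTrigPoly_of_mem (D := 2 * d) ?_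
  have hmem : f ∈ closure (trigPoly (2 * d) : Set C(Circle, ℂ)) := by
    rw [Metric.mem_closure_iff]
    intro ε hε
    have hf' : f ∈ (Submodule.span ℂ (Set.range mono)).topologicalClosure := by
      rw [span_mono_topologicalClosure]; trivial
    obtain ⟨g, hg, hfg⟩ := Metric.mem_closure_iff.mp hf' ε hε
    obtain ⟨D, hD⟩ := exists_mem_trigPoly_of_mem_span hg
    refine ⟨(lam⁻¹) ^ (D + (2 * d).natAbs) • R^[D + (2 * d).natAbs] g,
      Submodule.smul_mem _ _ (trigPoly_mono ?_ (hdeg _ D g hD)), ?_⟩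
    · have := neg_abs_le (2 * d)
      push_cast
      omega
    · rw [dist_eq_norm] at hfg ⊢
      exact (hnorm _ g).trans_lt hfg
  rwa [hcl.closure_eq] at hmem

/-! ### Products of weights along backward paths -/

/-- The `n`-th point `u_n e^{ix / Nⁿ}` of the backward path that starts at `u_0 e^{ix}` and is
asymptotic to the backward path `u`. -/
noncomputable def pathPt (N : ℕ) (u : ℕ → Circle) (x : ℝ) (n : ℕ) : Circle :=
  u n * Circle.exp (x / (N : ℝ) ^ n)

/-- The probability of following that path for the first `n` steps. -/
noncomputable def pathProd (N : ℕ) (W : Circle → ℝ) (u : ℕ → Circle) (n : ℕ) (x : ℝ) : ℝ :=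
  ∏ m ∈ Finset.range n, W (pathPt N u x (m + 1))

/-- The probability of following that path forever. -/
noncomputable def pathLim (N : ℕ) (W : Circle → ℝ) (u : ℕ → Circle) (x : ℝ) : ℝ :=
  ⨅ n, pathProd N W u n x

/-- The sum of these probabilities over all the paths that start at `u_0 e^{iy}` and are
asymptotic to `u`. -/
noncomputable def pathSum (N : ℕ) (W : Circle → ℝ) (u : ℕ → Circle) (y : ℝ) : ℝ :=
  ∑' j : ℤ, pathLim N W u (y + 2 * j * Real.pi)

/-- The probability that a backward path from `z` is asymptotic to `u`. -/
noncomputable def hitProb (N : ℕ) (W : Circle → ℝ) (u : ℕ → Circle) (z : Circle) : ℝ :=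
  pathSum N W u (Complex.arg ((u 0)⁻¹ * z : Circle))

theorem pathPt_succ_pow {N : ℕ} [NeZero N] {u : ℕ → Circle} (hu : ∀ n, u (n + 1) ^ N = u n)
    (x : ℝ) (n : ℕ) : pathPt N u x (n + 1) ^ N = pathPt N u x n := by
  have hN : (N : ℝ) ≠ 0 := Nat.cast_ne_zero.mpr (NeZero.ne N)
  rw [pathPt, mul_pow, hu, pathPt, ← Circle.exp_natCast_mul]
  congr 2
  field_simp
  ring

theorem pathPt_pow {N : ℕ} [NeZero N] {u : ℕ → Circle} (hu : ∀ n, u (n + 1) ^ N = u n)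
    (x : ℝ) (n m : ℕ) : pathPt N u x (n + m) ^ N ^ m = pathPt N u x n := by
  induction m with
  | zero => simp
  | succ m ih => rw [pow_succ', pow_mul, ← add_assoc, pathPt_succ_pow hu, ih]

theorem norm_prod_sub_prod_le {R : Type*} [NormedCommRing R] [NormOneClass R] {a b : ℕ → R}
    (ha : ∀ n, ‖a n‖ ≤ 1) (hb : ∀ n, ‖b n‖ ≤ 1) (n : ℕ) :
    ‖∏ m ∈ Finset.range n, a m - ∏ m ∈ Finset.range n, b m‖ ≤
      ∑ m ∈ Finset.range n, ‖a m - b m‖ := by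
  induction n with
  | zero => simp
  | succ n ih =>
    rw [Finset.prod_range_succ, Finset.prod_range_succ, Finset.sum_range_succ]
    set A := ∏ m ∈ Finset.range n, a m
    set B := ∏ m ∈ Finset.range n, b m with hB
    have hB1 : ‖B‖ ≤ 1 := (Finset.norm_prod_le _ _).trans
      (Finset.prod_le_one (fun m _ => norm_nonneg _) fun m _ => hb m)
    calc ‖A * a n - B * b n‖ = ‖(A - B) * a n + B * (a n - b n)‖ := by congr 1; ring
      _ ≤ ‖A - B‖ * ‖a n‖ + ‖B‖ * ‖a n - b n‖ :=
        (norm_add_le _ _).trans (add_le_add (norm_mul_le _ _) (norm_mul_le _ _))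
      _ ≤ ‖A - B‖ + ‖a n - b n‖ := by
        gcongr
        · exact mul_le_of_le_one_right (norm_nonneg _) (ha n)
        · exact mul_le_of_le_one_left (norm_nonneg _) hB1
      _ ≤ _ := by gcongr

section Bounds

variable {N : ℕ} {W : Circle → ℝ} {u : ℕ → Circle}

theorem pathProd_nonneg (hW : ∀ w, 0 ≤ W w) (n : ℕ) (x : ℝ) : 0 ≤ pathProd N W u n x :=
  Finset.prod_nonneg fun _ _ => hW _

theorem antitone_pathProd (hW : ∀ w, 0 ≤ W w) (hW1 : ∀ w, W w ≤ 1) (x : ℝ) :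
    Antitone fun n => pathProd N W u n x :=
  antitone_nat_of_succ_le fun n => by
    rw [pathProd, Finset.prod_range_succ]
    exact mul_le_of_le_one_right (pathProd_nonneg hW n x) (hW1 _)

theorem bddBelow_pathProd (hW : ∀ w, 0 ≤ W w) (x : ℝ) :
    BddBelow (Set.range fun n => pathProd N W u n x) :=
  ⟨0, by rintro _ ⟨n, rfl⟩; exact pathProd_nonneg hW n x⟩

theorem tendsto_pathProd (hW : ∀ w, 0 ≤ W w) (hW1 : ∀ w, W w ≤ 1) (x : ℝ) :
    Filter.Tendsto (fun n => pathProd N W u n x) Filter.atTop (nhds (pathLim N W u x)) :=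
  tendsto_atTop_ciInf (antitone_pathProd hW hW1 x) (bddBelow_pathProd hW x)

theorem pathLim_nonneg (hW : ∀ w, 0 ≤ W w) (x : ℝ) : 0 ≤ pathLim N W u x :=
  le_ciInf fun n => pathProd_nonneg hW n x

theorem pathLim_le (hW : ∀ w, 0 ≤ W w) (n : ℕ) (x : ℝ) : pathLim N W u x ≤ pathProd N W u n x :=
  ciInf_le (bddBelow_pathProd hW x) n

theorem sum_inv_pow_le_one (hN : 2 ≤ N) (n : ℕ) :
    ∑ m ∈ Finset.range n, 1 / (N : ℝ) ^ (m + 1) ≤ 1 - 1 / (N : ℝ) ^ n := by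
  have hN2 : (2 : ℝ) ≤ N := by exact_mod_cast hN
  induction n with
  | zero => simp
  | succ n ih =>
    rw [Finset.sum_range_succ]
    have h : 2 * (1 / (N : ℝ) ^ (n + 1)) ≤ 1 / (N : ℝ) ^ n := by
      rw [pow_succ, one_div, one_div, mul_inv]
      have h1 : 2 * (N : ℝ)⁻¹ ≤ 1 := by
        rw [← div_eq_mul_inv]; exact (div_le_one (by linarith)).mpr hN2
      have h2 : 0 ≤ ((N : ℝ) ^ n)⁻¹ := by positivity
      nlinarith
    linarith

/-- The products along paths are equi-Lipschitz in the asymptotic position `x`, because the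
distance of two paths that are asymptotic to each other decays geometrically. -/
theorem abs_pathProd_sub_le (hN : 2 ≤ N) (hW : ∀ w, 0 ≤ W w) (hW1 : ∀ w, W w ≤ 1) {L : ℝ}
    (hL : ∀ (c : Circle) (x y : ℝ),
      |W (c * Circle.exp x) - W (c * Circle.exp y)| ≤ L * |x - y|) (n : ℕ) (x y : ℝ) :
    |pathProd N W u n x - pathProd N W u n y| ≤ L * |x - y| := by
  have hL0 : 0 ≤ L := by simpa using (abs_nonneg _).trans (hL 1 1 0)
  have hN0 : (0 : ℝ) < N := by exact_mod_cast (by omega : 0 < N)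
  have hn : ∀ w, ‖W w‖ ≤ 1 := fun w => by rw [Real.norm_of_nonneg (hW w)]; exact hW1 w
  refine (norm_prod_sub_prod_le (fun _ => hn _) (fun _ => hn _) n).trans ?_
  calc _ ≤ ∑ m ∈ Finset.range n, L * |x - y| * (1 / (N : ℝ) ^ (m + 1)) := by
        refine Finset.sum_le_sum fun m _ => (hL _ _ _).trans_eq ?_
        rw [← sub_div, abs_div, abs_of_pos (pow_pos hN0 _)]
        ring
    _ = L * |x - y| * ∑ m ∈ Finset.range n, 1 / (N : ℝ) ^ (m + 1) := by rw [Finset.mul_sum]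
    _ ≤ L * |x - y| * 1 := by
        have h1 := sum_inv_pow_le_one hN n
        have h2 : 0 ≤ 1 / (N : ℝ) ^ n := by positivity
        have h3 : 0 ≤ L * |x - y| := by positivity
        exact mul_le_mul_of_nonneg_left (by linarith) h3
    _ = _ := mul_one _

theorem continuous_pathLim (hN : 2 ≤ N) (hW : ∀ w, 0 ≤ W w) (hW1 : ∀ w, W w ≤ 1) {L : ℝ}
    (hL : ∀ (c : Circle) (x y : ℝ),
      |W (c * Circle.exp x) - W (c * Circle.exp y)| ≤ L * |x - y|) :
    Continuous (pathLim N W u) := by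
  have hL0 : 0 ≤ L := by simpa using (abs_nonneg _).trans (hL 1 1 0)
  refine (LipschitzWith.of_dist_le_mul (K := ⟨L, hL0⟩) fun x y => ?_).continuous
  rw [Real.dist_eq, Real.dist_eq]
  exact le_of_tendsto' (((tendsto_pathProd hW hW1 x).sub (tendsto_pathProd hW hW1 y)).abs)
    fun n => abs_pathProd_sub_le hN hW hW1 hL n x y

theorem pathLim_zero (hu1 : ∀ n, W (u n) = 1) : pathLim N W u 0 = 1 := by
  simp [pathLim, pathProd, pathPt, hu1]

theorem pathLim_eq_mul_shift (hW : ∀ w, 0 ≤ W w) (hW1 : ∀ w, W w ≤ 1) (x : ℝ) :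
    pathLim N W u x =
      W (u 1 * Circle.exp (x / N)) * pathLim N W (fun n => u (n + 1)) (x / N) := by
  have h1 := (tendsto_pathProd (N := N) (u := u) hW hW1 x).comp (Filter.tendsto_add_atTop_nat 1)
  have h2 := (tendsto_pathProd (N := N) (u := fun n => u (n + 1)) hW hW1 (x / N)).const_mul
    (W (u 1 * Circle.exp (x / N)))
  refine tendsto_nhds_unique (h1.congr fun n => ?_) h2
  simp only [Function.comp_apply, pathProd, pathPt]
  rw [Finset.prod_range_succ', mul_comm]
  congr 1
  · simp
  · refine Finset.prod_congr rfl fun m _ => ?_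
    rw [div_div, ← pow_succ']

end Bounds

theorem pathSum_periodic (N : ℕ) (W : Circle → ℝ) (u : ℕ → Circle) :
    Function.Periodic (pathSum N W u) (2 * Real.pi) := by
  intro x
  unfold pathSum
  rw [← (Equiv.addRight (1 : ℤ)).tsum_eq (fun k : ℤ => pathLim N W u (x + 2 * k * Real.pi))]
  refine tsum_congr fun k => ?_
  simp only [Equiv.coe_addRight]
  push_cast
  congr 1
  ring

theorem hitProb_mul_exp (N : ℕ) (W : Circle → ℝ) (u : ℕ → Circle) (y : ℝ) :
    hitProb N W u (u 0 * Circle.exp y) = pathSum N W u y := by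
  rw [hitProb, inv_mul_cancel_left]
  obtain ⟨m, hm⟩ := Circle.exp_eq_exp.mp (Circle.exp_arg (Circle.exp y))
  rw [hm]
  exact (pathSum_periodic N W u).int_mul m y

theorem pathSum_nonneg {N : ℕ} {W : Circle → ℝ} {u : ℕ → Circle} (hW : ∀ w, 0 ≤ W w) (y : ℝ) :
    0 ≤ pathSum N W u y :=
  tsum_nonneg fun _ => pathLim_nonneg hW _

/-- First-step analysis: averaging the hitting probability of the shifted path over the preimages
of `z` gives the hitting probability of the path from `z`. -/
theorem sum_weight_mul_hitProb {N : ℕ} [NeZero N] {W : Circle → ℝ} {u : ℕ → Circle}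
    (hW : ∀ w, 0 ≤ W w) (hW1 : ∀ w, W w ≤ 1) (hu : ∀ n, u (n + 1) ^ N = u n)
    (hs : ∀ y, Summable fun j : ℤ => pathLim N W u (y + 2 * j * Real.pi)) (z : Circle) :
    ∑ w ∈ preim N z, W w * hitProb N W (fun n => u (n + 1)) w = hitProb N W u z := by
  have hN : (N : ℝ) ≠ 0 := Nat.cast_ne_zero.mpr (NeZero.ne N)
  obtain ⟨a, ha⟩ := Circle.exp_surjective (u 1)
  obtain ⟨y, hy⟩ := Circle.exp_surjective ((u 0)⁻¹ * z)
  have hz : z = u 0 * Circle.exp y := by rw [hy, mul_inv_cancel_left]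
  have hz' : z = Circle.exp (N * a + y) := by
    rw [hz, ← hu 0, zero_add, ← ha, Circle.exp_add, Circle.exp_natCast_mul]
  have hpt : ∀ k : ℕ, Circle.exp ((N * a + y + 2 * Real.pi * k) / N) =
      u 1 * Circle.exp ((y + 2 * Real.pi * k) / N) := by
    intro k
    rw [← ha, ← Circle.exp_add]
    congr 1
    field_simp
    ring
  set F : ℤ → ℝ := fun j => pathLim N W u (y + 2 * j * Real.pi) with hF
  have hterm : ∀ k : Fin N, W (u 1 * Circle.exp ((y + 2 * Real.pi * (k : ℕ)) / N)) *
      hitProb N W (fun n => u (n + 1)) (u 1 * Circle.exp ((y + 2 * Real.pi * (k : ℕ)) / N)) =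
      ∑' j : ℤ, F ((Int.divModEquiv N).symm (j, k)) := by
    intro k
    rw [hitProb_mul_exp N W (fun n => u (n + 1)), pathSum, ← tsum_mul_left]
    refine tsum_congr fun j => ?_
    have hx : y + 2 * ((((Int.divModEquiv N).symm (j, k) : ℤ)) : ℝ) * Real.pi =
        N * ((y + 2 * Real.pi * (k : ℕ)) / N + 2 * j * Real.pi) := by
      simp only [Int.divModEquiv, Equiv.coe_fn_symm_mk]
      push_cast
      field_simp
      ring
    rw [hF]
    simp only
    rw [hx, pathLim_eq_mul_shift (u := u) hW hW1, mul_div_cancel_left₀ _ hN]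
    congr 2
    rw [show (y + 2 * Real.pi * ((k : ℕ) : ℝ)) / N + 2 * j * Real.pi =
      (y + 2 * Real.pi * ((k : ℕ) : ℝ)) / N + j * (2 * Real.pi) by ring, Circle.exp_add,
      Circle.exp_int_mul_two_pi, mul_one]
  rw [hz', sum_preim_exp_real (fun w => W w * hitProb N W (fun n => u (n + 1)) w), ← hz', hz,
    hitProb_mul_exp, Finset.sum_range]
  simp only [hpt, hterm]
  have hsF : Summable fun p : Fin N × ℤ => F ((Int.divModEquiv N).symm (p.2, p.1)) :=
    (hs y).comp_injective ((Int.divModEquiv N).symm.injective.comp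
      (Equiv.prodComm _ _).injective)
  calc ∑ k : Fin N, ∑' j : ℤ, F ((Int.divModEquiv N).symm (j, k))
      = ∑' p : Fin N × ℤ, F ((Int.divModEquiv N).symm (p.2, p.1)) := by
        rw [hsF.tsum_prod, tsum_fintype]
    _ = ∑' j, F j :=
        ((Equiv.prodComm _ _).trans (Int.divModEquiv N).symm).tsum_eq F

/-- The probability that the first `n` backward steps from `z` lead to a given set is at most
`1`. -/
theorem sum_prod_weight_le_one {N : ℕ} [NeZero N] {W : Circle → ℝ} (hW : ∀ w, 0 ≤ W w)
    (hsum : ∀ z, ∑ w ∈ preim N z, W w = 1) (n : ℕ) (z : Circle) (T : Finset Circle)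
    (hT : ∀ w ∈ T, w ^ N ^ n = z) : ∑ w ∈ T, ∏ m ∈ Finset.range n, W (w ^ N ^ m) ≤ 1 := by
  classical
  induction n generalizing T with
  | zero =>
    simp only [Finset.range_zero, Finset.prod_empty, Finset.sum_const, nsmul_eq_mul, mul_one]
    have : T ⊆ {z} := fun w hw => by simpa using hT w hw
    exact_mod_cast Finset.card_le_card this
  | succ n ih =>
    have hT' : ∀ v ∈ T.image (· ^ N), v ^ N ^ n = z := by
      intro v hv
      obtain ⟨w, hw, rfl⟩ := Finset.mem_image.mp hv
      rw [← pow_mul, ← pow_succ', hT w hw]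
    refine le_trans ?_ (ih _ hT')
    rw [← Finset.sum_fiberwise_of_maps_to (g := (· ^ N)) (t := T.image (· ^ N))
      fun w hw => Finset.mem_image_of_mem _ hw]
    refine Finset.sum_le_sum fun v _ => ?_
    calc ∑ w ∈ T with w ^ N = v, ∏ m ∈ Finset.range (n + 1), W (w ^ N ^ m)
        = ∑ w ∈ T with w ^ N = v, (∏ m ∈ Finset.range n, W (v ^ N ^ m)) * W w := by
          refine Finset.sum_congr rfl fun w hw => ?_
          rw [Finset.prod_range_succ', ← (Finset.mem_filter.mp hw).2]
          congr 1
          · exact Finset.prod_congr rfl fun m _ => by rw [← pow_mul, ← pow_succ']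
          · simp
      _ = (∏ m ∈ Finset.range n, W (v ^ N ^ m)) * ∑ w ∈ T with w ^ N = v, W w := by
          rw [Finset.mul_sum]
      _ ≤ (∏ m ∈ Finset.range n, W (v ^ N ^ m)) * 1 := by
          refine mul_le_mul_of_nonneg_left ?_ (Finset.prod_nonneg fun _ _ => hW _)
          rw [← hsum v]
          exact Finset.sum_le_sum_of_subset_of_nonneg
            (fun w hw => mem_preim.mpr (Finset.mem_filter.mp hw).2) fun w _ _ => hW w
      _ = _ := mul_one _

theorem pathProd_eq_prod_pow {N : ℕ} [NeZero N] {W : Circle → ℝ} {u : ℕ → Circle}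
    (hu : ∀ n, u (n + 1) ^ N = u n) (n : ℕ) (x : ℝ) :
    pathProd N W u n x = ∏ m ∈ Finset.range n, W (pathPt N u x n ^ N ^ m) := by
  rw [pathProd, ← Finset.prod_range_reflect]
  refine Finset.prod_congr rfl fun m hm => ?_
  have hm' := Finset.mem_range.mp hm
  rw [← pathPt_pow hu x (n - 1 - m + 1) m]
  congr 3
  omega

/-! ### The hitting probabilities of the cycles -/

section Family

variable {N : ℕ} {W : Circle → ℝ} {ι : Type*} {pt : ι → Circle}
  {pr : Equiv.Perm ι}

/-- The backward path `pt c, pt (pr c), pt (pr (pr c)), …` along a cycle, `pr` being the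
predecessor. -/
def cyclePath (pt : ι → Circle) (pr : Equiv.Perm ι) (c : ι) (n : ℕ) : Circle := pt ((pr ^ n) c)

theorem cyclePath_zero (c : ι) : cyclePath pt pr c 0 = pt c := rfl

theorem cyclePath_shift (c : ι) :
    (fun n => cyclePath pt pr c (n + 1)) = cyclePath pt pr (pr c) := by
  funext n
  rw [cyclePath, cyclePath, pow_succ]
  rfl

theorem cyclePath_succ_pow (hpr : ∀ c, pt (pr c) ^ N = pt c) (c : ι) (n : ℕ) :
    cyclePath pt pr c (n + 1) ^ N = cyclePath pt pr c n := by
  rw [cyclePath, pow_succ', Equiv.Perm.mul_apply, hpr]; rfl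

/-- Paths which are asymptotic to different cycle points, or to the same one in different ways,
are different. -/
theorem exists_pathPt_ne [Finite ι] (hN : 2 ≤ N) (hinj : Function.Injective pt)
    {z : Circle} {c c' : ι} {j j' : ℤ} (hne : (c, j) ≠ (c', j')) : ∃ n,
      pathPt N (cyclePath pt pr c) (Complex.arg ((pt c)⁻¹ * z : Circle) + 2 * j * Real.pi) n ≠
      pathPt N (cyclePath pt pr c')
        (Complex.arg ((pt c')⁻¹ * z : Circle) + 2 * j' * Real.pi) n := by
  by_contra! h
  have hN1 : (1 : ℝ) < N := by exact_mod_cast hN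
  have hlim : ∀ (c : ι) (x : ℝ), Filter.Tendsto
      (fun n => pathPt N (cyclePath pt pr c) x (n * orderOf pr)) Filter.atTop (nhds (pt c)) := by
    intro c x
    have h1 : ∀ n, cyclePath pt pr c (n * orderOf pr) = pt c := by
      intro n
      rw [cyclePath, mul_comm, pow_mul, pow_orderOf_eq_one, one_pow]; rfl
    have h2 : Filter.Tendsto (fun n : ℕ => n * orderOf pr) Filter.atTop Filter.atTop :=
      Filter.tendsto_id.atTop_mul_const' (orderOf_pos pr)
    have h3 : Filter.Tendsto (fun n : ℕ => Circle.exp (x / (N : ℝ) ^ (n * orderOf pr)))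
        Filter.atTop (nhds (Circle.exp 0)) :=
      (Circle.exp.continuous.tendsto 0).comp (tendsto_const_nhds.div_atTop
        ((tendsto_pow_atTop_atTop_of_one_lt hN1).comp h2))
    have h4 := h3.const_mul (pt c)
    rw [Circle.exp_zero, mul_one] at h4
    exact h4.congr fun n => by rw [pathPt, h1]
  have hc : c = c' := hinj (tendsto_nhds_unique
    ((hlim c _).congr fun n => h (n * orderOf pr)) (hlim c' _))
  subst hc
  refine hne (Prod.ext rfl (sub_eq_zero.mp ?_))
  set n := (j - j').natAbs
  have h1 := mul_left_cancel (h n)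
  obtain ⟨m, hm⟩ := Circle.exp_eq_exp.mp h1
  have hNn : (N : ℝ) ^ n ≠ 0 := by positivity
  have h2 : ((j - j' : ℤ) : ℝ) = ((N ^ n * m : ℤ) : ℝ) := by
    push_cast
    have := Real.pi_pos
    field_simp at hm
    have h3 : (2 * Real.pi) * ((j : ℝ) - j') = (2 * Real.pi) * ((N : ℝ) ^ n * m) := by
      linear_combination hm
    exact mul_left_cancel₀ (by positivity) h3
  have h3 : j - j' = N ^ n * m := by exact_mod_cast h2
  refine Int.eq_zero_of_abs_lt_dvd ⟨m, h3⟩ ?_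
  rw [Int.abs_eq_natAbs]
  exact_mod_cast Nat.lt_pow_self (by omega)

variable [NeZero N] [Fintype ι] (hN : 2 ≤ N) (hW : ∀ w, 0 ≤ W w)
  (hsum : ∀ z, ∑ w ∈ preim N z, W w = 1) (hinj : Function.Injective pt)
  (hpr : ∀ c, pt (pr c) ^ N = pt c)

include hN hW hsum hinj hpr in
theorem sum_pathLim_le_one (z : Circle) (J : Finset (ι × ℤ)) :
    ∑ a ∈ J, pathLim N W (cyclePath pt pr a.1)
      (Complex.arg ((pt a.1)⁻¹ * z : Circle) + 2 * a.2 * Real.pi) ≤ 1 := by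
  classical
  set v : ι × ℤ → ℕ → Circle := fun a => pathPt N (cyclePath pt pr a.1)
    (Complex.arg ((pt a.1)⁻¹ * z : Circle) + 2 * a.2 * Real.pi) with hv
  have hvpow : ∀ a n m, v a (n + m) ^ N ^ m = v a n := fun a n m =>
    pathPt_pow (cyclePath_succ_pow hpr a.1) _ n m
  have hv0 : ∀ a, v a 0 = z := by
    intro a
    rw [hv]
    simp only [pathPt, pow_zero, div_one, cyclePath_zero]
    rw [Circle.exp_add, show 2 * (a.2 : ℝ) * Real.pi = a.2 * (2 * Real.pi) by ring,
      Circle.exp_int_mul_two_pi, mul_one, Circle.exp_arg, mul_inv_cancel_left]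
  have hev : ∀ᶠ n in Filter.atTop, ∀ a ∈ J, ∀ b ∈ J, a ≠ b → v a n ≠ v b n := by
    rw [Finset.eventually_all]
    intro a _
    rw [Finset.eventually_all]
    intro b _
    by_cases hab : a = b
    · exact Filter.Eventually.of_forall fun _ h => (h hab).elim
    · obtain ⟨n₀, hn₀⟩ := exists_pathPt_ne (pr := pr) (z := z) hN hinj (c := a.1) (j := a.2)
        (c' := b.1) (j' := b.2) hab
      filter_upwards [Filter.eventually_ge_atTop n₀] with n hn _ h
      obtain ⟨m, rfl⟩ := Nat.exists_eq_add_of_le hn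
      exact hn₀ (by rw [← hvpow a n₀ m, ← hvpow b n₀ m, h] : v a n₀ = v b n₀)
  obtain ⟨n, hn⟩ := hev.exists
  have hinjOn : Set.InjOn (fun a => v a n) J := fun a ha b hb hab => by
    by_contra hne
    exact hn a ha b hb hne hab
  calc _ ≤ ∑ a ∈ J, ∏ m ∈ Finset.range n, W (v a n ^ N ^ m) := by
        refine Finset.sum_le_sum fun a _ => (pathLim_le hW n _).trans_eq ?_
        exact pathProd_eq_prod_pow (cyclePath_succ_pow hpr a.1) n _
    _ = ∑ w ∈ J.image (fun a => v a n), ∏ m ∈ Finset.range n, W (w ^ N ^ m) :=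
        (Finset.sum_image (f := fun w => ∏ m ∈ Finset.range n, W (w ^ N ^ m)) hinjOn).symm
    _ ≤ 1 := by
        refine sum_prod_weight_le_one hW hsum n z _ fun w hw => ?_
        obtain ⟨a, _, rfl⟩ := Finset.mem_image.mp hw
        have := hvpow a 0 n
        rw [zero_add, hv0] at this
        exact this

include hN hW hsum hinj hpr in
theorem summable_pathLim_prod (z : Circle) : Summable fun a : ι × ℤ =>
    pathLim N W (cyclePath pt pr a.1)
      (Complex.arg ((pt a.1)⁻¹ * z : Circle) + 2 * a.2 * Real.pi) :=
  summable_of_sum_le (fun _ => pathLim_nonneg hW _)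
    (sum_pathLim_le_one hN hW hsum hinj hpr z)

include hN hW hsum hinj hpr in
theorem sum_hitProb_le_one (z : Circle) :
    ∑ c, hitProb N W (cyclePath pt pr c) z ≤ 1 := by
  have hs := summable_pathLim_prod hN hW hsum hinj hpr z
  have h1 : ∑ c, hitProb N W (cyclePath pt pr c) z = ∑' a : ι × ℤ,
      pathLim N W (cyclePath pt pr a.1)
        (Complex.arg ((pt a.1)⁻¹ * z : Circle) + 2 * a.2 * Real.pi) := by
    rw [hs.tsum_prod, tsum_fintype]
    rfl
  rw [h1]
  exact hs.tsum_le_of_sum_le (sum_pathLim_le_one hN hW hsum hinj hpr z)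

include hN hW hsum hinj hpr in
theorem summable_pathLim (c : ι) (y : ℝ) :
    Summable fun j : ℤ => pathLim N W (cyclePath pt pr c) (y + 2 * j * Real.pi) := by
  have hs := (summable_pathLim_prod hN hW hsum hinj hpr (pt c * Circle.exp y)).comp_injective
    (i := fun j : ℤ => (c, j)) (fun a b h => (Prod.ext_iff.mp h).2)
  obtain ⟨m, hm⟩ := Circle.exp_eq_exp.mp (Circle.exp_arg (Circle.exp y))
  rw [← (Equiv.addLeft m).summable_iff]
  refine hs.congr fun j => ?_
  simp only [Function.comp_apply, inv_mul_cancel_left, hm, Equiv.coe_addLeft]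
  push_cast
  congr 1
  ring

include hN hW hsum hinj hpr in
theorem pathSum_le_one (c : ι) (y : ℝ) : pathSum N W (cyclePath pt pr c) y ≤ 1 := by
  have h1 := sum_hitProb_le_one hN hW hsum hinj hpr (pt c * Circle.exp y)
  have h2 := Finset.single_le_sum (f := fun c' => hitProb N W (cyclePath pt pr c')
    (pt c * Circle.exp y)) (fun _ _ => pathSum_nonneg hW _) (Finset.mem_univ c)
  have h3 := hitProb_mul_exp N W (cyclePath pt pr c) y
  rw [cyclePath_zero] at h3
  rw [← h3]
  exact h2.trans h1

include hN hW hsum hinj hpr in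
theorem sum_weight_mul_hitProb_cyclePath (c : ι) (z : Circle) :
    ∑ w ∈ preim N z, W w * hitProb N W (cyclePath pt pr (pr c)) w =
      hitProb N W (cyclePath pt pr c) z := by
  rw [← cyclePath_shift]
  exact sum_weight_mul_hitProb hW (weight_le_one hW hsum) (cyclePath_succ_pow hpr c)
    (summable_pathLim hN hW hsum hinj hpr c) z

variable {L : ℝ} (hL : ∀ (c : Circle) (x y : ℝ),
    |W (c * Circle.exp x) - W (c * Circle.exp y)| ≤ L * |x - y|)

include hN hW hsum hinj hpr hL in
theorem lowerSemicontinuous_hitProb (c : ι) :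
    LowerSemicontinuous (hitProb N W (cyclePath pt pr c)) := by
  -- a sum of nonnegative continuous functions is lower semicontinuous
  have h1 : LowerSemicontinuous (pathSum N W (cyclePath pt pr c)) := by
    intro y a ha
    have hs := summable_pathLim hN hW hsum hinj hpr c
    obtain ⟨s, hs'⟩ := ((hs y).hasSum.eventually_const_lt ha).exists
    have hc : Continuous fun y' : ℝ =>
        ∑ j ∈ s, pathLim N W (cyclePath pt pr c) (y' + 2 * j * Real.pi) :=
      continuous_finsetSum _ fun j _ =>
        (continuous_pathLim hN hW (weight_le_one hW hsum) hL).comp (by fun_prop)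
    filter_upwards [hc.continuousAt.eventually_const_lt hs'] with y' hy'
    exact hy'.trans_le ((hs y').sum_le_tsum s fun _ _ => pathLim_nonneg hW _)
  rw [lowerSemicontinuous_iff_isOpen_preimage] at h1 ⊢
  intro a
  have hq : Topology.IsQuotientMap fun y => pt c * Circle.exp y :=
    (Homeomorph.mulLeft (pt c)).isQuotientMap.comp
      (Circle.isCoveringMap_exp.isQuotientMap Circle.exp_surjective)
  rw [← hq.isOpen_preimage, ← Set.preimage_comp]
  convert h1 a using 2
  funext y
  exact hitProb_mul_exp N W (cyclePath pt pr c) y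

variable (hpt : ∀ c, W (pt c) = 1)

include hN hW hsum hinj hpr hpt in
theorem one_le_hitProb (c : ι) : 1 ≤ hitProb N W (cyclePath pt pr c) (pt c) := by
  have h := hitProb_mul_exp N W (cyclePath pt pr c) 0
  rw [cyclePath_zero, Circle.exp_zero, mul_one] at h
  rw [h, ← pathLim_zero (N := N) (W := W) (u := cyclePath pt pr c) fun n => hpt _]
  have h2 := (summable_pathLim hN hW hsum hinj hpr c 0).le_tsum 0 fun _ _ => pathLim_nonneg hW _
  simpa [pathSum] using h2

variable (hZ : {w | W w = 0}.Finite) (h1 : W 1 = 1)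
  (hall : ∀ c, IsCyclePt N W c → c ∈ Set.range pt)

include hN hW hsum hinj hpr hL hpt hZ h1 hall in
/-- Backward paths are almost surely asymptotic to a cycle of weight `1`: the hitting
probabilities have sum `1`. Otherwise their sum would assume its minimum, a value less than
`1`, on a closed invariant set, which meets a cycle; but the sum is `1` there. -/
theorem sum_hitProb_eq_one (z : Circle) : ∑ c, hitProb N W (cyclePath pt pr c) z = 1 := by
  set S : Circle → ℝ := fun z => ∑ c, hitProb N W (cyclePath pt pr c) z with hS
  refine le_antisymm (sum_hitProb_le_one hN hW hsum hinj hpr z) ?_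
  have hlsc : LowerSemicontinuous S :=
    lowerSemicontinuous_sum fun c _ => lowerSemicontinuous_hitProb hN hW hsum hinj hpr hL c
  have hRS : ∀ z, ∑ w ∈ preim N z, W w * S w = S z := by
    intro z
    simp only [hS, Finset.mul_sum]
    rw [Finset.sum_comm, ← Equiv.sum_comp pr]
    exact Finset.sum_congr rfl fun c _ =>
      sum_weight_mul_hitProb_cyclePath hN hW hsum hinj hpr c z
  obtain ⟨z₀, -, hz₀⟩ := LowerSemicontinuousOn.exists_isMinOn
    (Set.univ_nonempty (α := Circle)) isCompact_univ (hlsc.lowerSemicontinuousOn _)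
  have hmin : ∀ w, S z₀ ≤ S w := fun w => hz₀ (Set.mem_univ w)
  have hinv : ∀ w, w ^ N ∈ S ⁻¹' Set.Iic (S z₀) → W w ≠ 0 → w ∈ S ⁻¹' Set.Iic (S z₀) := by
    intro w hw hw0
    by_contra hlt
    have hlt' : S z₀ < S w := not_le.mp hlt
    refine absurd (show S (w ^ N) ≤ S z₀ from hw) (not_le.mpr ?_)
    rw [← hRS (w ^ N)]
    calc S z₀ = ∑ v ∈ preim N (w ^ N), W v * S z₀ := by rw [← Finset.sum_mul, hsum, one_mul]
      _ < _ := Finset.sum_lt_sum (fun v _ => mul_le_mul_of_nonneg_left (hmin v) (hW v))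
          ⟨w, mem_preim.mpr rfl, mul_lt_mul_of_pos_left hlt'
            (lt_of_le_of_ne (hW w) (Ne.symm hw0))⟩
  obtain ⟨_, hcF, hc⟩ := exists_isCyclePt_of_isClosed hN hsum hZ h1
    (hlsc.isClosed_preimage (S z₀)) ⟨z₀, le_refl (S z₀)⟩ hinv
  obtain ⟨c, rfl⟩ := hall _ hc
  calc (1 : ℝ) ≤ hitProb N W (cyclePath pt pr c) (pt c) :=
        one_le_hitProb hN hW hsum hinj hpr hpt c
    _ ≤ S (pt c) := Finset.single_le_sum (f := fun c' => hitProb N W (cyclePath pt pr c') (pt c))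
        (fun _ _ => pathSum_nonneg hW _) (Finset.mem_univ c)
    _ ≤ S z₀ := hcF
    _ ≤ S z := hmin z

include hN hW hsum hinj hpr hL hpt hZ h1 hall in
/-- Each hitting probability is `1` minus the sum of the others, hence upper semicontinuous as
well. -/
theorem continuous_hitProb (c : ι) : Continuous (hitProb N W (cyclePath pt pr c)) := by
  classical
  have hl := lowerSemicontinuous_hitProb hN hW hsum hinj hpr hL
  refine continuous_iff_lower_upperSemicontinuous.mpr ⟨hl c, ?_⟩
  have heq : hitProb N W (cyclePath pt pr c) = fun z =>
      1 - ∑ c' ∈ Finset.univ.erase c, hitProb N W (cyclePath pt pr c') z := by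
    funext z
    rw [← sum_hitProb_eq_one hN hW hsum hinj hpr hL hpt hZ h1 hall z,
      ← Finset.add_sum_erase _ _ (Finset.mem_univ c)]
    ring
  have hl' : LowerSemicontinuous fun z =>
      ∑ c' ∈ Finset.univ.erase c, hitProb N W (cyclePath pt pr c') z :=
    lowerSemicontinuous_sum fun c' _ => hl c'
  rw [heq]
  intro z a ha
  filter_upwards [hl' z (1 - a) (by linarith)] with z' hz'
  linarith

include hN hW hsum hinj hpr hpt in
theorem hitProb_apply_pt [DecidableEq ι] (c c' : ι) :
    hitProb N W (cyclePath pt pr c) (pt c') = if c = c' then 1 else 0 := by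
  have hle := sum_hitProb_le_one hN hW hsum hinj hpr (pt c')
  have hge := one_le_hitProb hN hW hsum hinj hpr hpt c'
  have hnn : ∀ c, 0 ≤ hitProb N W (cyclePath pt pr c) (pt c') := fun c => pathSum_nonneg hW _
  rw [← Finset.add_sum_erase _ _ (Finset.mem_univ c')] at hle
  have hnn' : 0 ≤ ∑ c ∈ Finset.univ.erase c', hitProb N W (cyclePath pt pr c) (pt c') :=
    Finset.sum_nonneg fun c _ => hnn c
  split_ifs with h
  · subst h; linarith
  · exact (Finset.sum_eq_zero_iff_of_nonneg fun c _ => hnn c).mp (by linarith) c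
      (Finset.mem_erase.mpr ⟨h, Finset.mem_univ c⟩)

end Family

/-! ### The infinite products -/

theorem finRotate_pow_apply (n j : ℕ) (k : Fin (n + 1)) :
    (finRotate (n + 1) ^ j) k = k + Fin.ofNat (n + 1) j := by
  induction j with
  | zero => simp
  | succ j ih =>
    rw [pow_succ', Equiv.Perm.mul_apply, ih, finRotate_apply]
    simp [Fin.ext_iff, Fin.val_add, Nat.add_assoc]

theorem prod_range_finRotate_pow {p : ℕ} (hp : 0 < p) (k : Fin p) (f : Fin p → ℂ) :
    ∏ j ∈ Finset.range p, f ((finRotate p ^ j) k) = ∏ k, f k := by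
  obtain ⟨n, rfl⟩ := Nat.exists_eq_succ_of_ne_zero hp.ne'
  rw [Finset.prod_range, ← Equiv.prod_comp (Equiv.addLeft k) f]
  refine Finset.prod_congr rfl fun j _ => ?_
  rw [finRotate_pow_apply, show Fin.ofNat (n + 1) (j : ℕ) = j from
    Fin.ext (Nat.mod_eq_of_lt j.2)]
  rfl

section Phi

variable {N : ℕ} {m₀ : C(Circle, ℂ)} {p : ℕ} {z : Fin p → Circle}

theorem IsMCycle.inv_finRotate_pow (hz : IsMCycle N m₀ z) (k : Fin p) :
    z ((finRotate p)⁻¹ k) ^ N = z k := by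
  rw [hz.1.2.2]
  exact congrArg z ((finRotate p).apply_symm_apply k)

theorem cyclePath_finRotate_mul (k : Fin p) (l : ℕ) :
    cyclePath z (finRotate p)⁻¹ k (l * p) = z k := by
  rw [cyclePath, inv_pow, mul_comm, pow_mul, finRotate_pow_self, one_pow, inv_one]
  rfl

theorem sqrt_natCast_pow (N p : ℕ) : Real.sqrt ((N : ℝ) ^ p) = Real.sqrt N ^ p := by
  rw [Real.sqrt_eq_iff_eq_sq (by positivity) (by positivity), ← pow_mul, mul_comm, pow_mul,
    Real.sq_sqrt (Nat.cast_nonneg N)]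

theorem IsMCycle.cyclePhase_eq (hz : IsMCycle N m₀ z) :
    cyclePhase m₀ z = ∏ k, m₀ (z k) / (Real.sqrt N : ℂ) :=
  Finset.prod_congr rfl fun k _ => by rw [hz.2]

theorem phiFactor_eq (k : Fin p) (x : ℝ) (l : ℕ) :
    phiFactor N m₀ z k x l = (cyclePhase m₀ z)⁻¹ * ∏ j ∈ Finset.range p,
      (m₀ ((z k * Circle.exp (x / (N : ℝ) ^ (l * p))) ^ N ^ j) / (Real.sqrt N : ℂ)) := by
  rw [phiFactor, rot, iterProd, sqrt_natCast_pow, Finset.prod_div_distrib, Finset.prod_const,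
    Finset.card_range, mul_div_assoc]
  push_cast
  rfl

variable [NeZero N]

theorem IsMCycle.norm_cyclePhase (hz : IsMCycle N m₀ z) : ‖cyclePhase m₀ z‖ = 1 := by
  have hN : 0 < (N : ℝ) := by exact_mod_cast NeZero.pos N
  rw [cyclePhase, norm_prod]
  refine Finset.prod_eq_one fun k _ => ?_
  rw [norm_div, Complex.norm_real, norm_norm, hz.2]
  exact div_self (Real.sqrt_pos.mpr hN).ne'

theorem norm_div_sqrt_le_one (hR1 : ruelleOp N m₀ 1 = 1) (w : Circle) :
    ‖m₀ w / (Real.sqrt N : ℂ)‖ ≤ 1 := by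
  have hN : 0 < (N : ℝ) := by exact_mod_cast NeZero.pos N
  have h := weight_le_one (weight_nonneg N m₀) (sum_weight hR1) w
  rw [weight, div_le_one hN] at h
  rw [norm_div, Complex.norm_real, Real.norm_of_nonneg (Real.sqrt_nonneg _),
    div_le_one (Real.sqrt_pos.mpr hN)]
  exact Real.le_sqrt_of_sq_le h

/-- The factors tend to `1` geometrically. -/
theorem IsMCycle.exists_norm_phiFactor_sub_one_le (hz : IsMCycle N m₀ z)
    (hLip : ∃ K, LipschitzWith K m₀) (hR1 : ruelleOp N m₀ 1 = 1) (k : Fin p) :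
    ∃ C : ℝ, ∀ x l, ‖phiFactor N m₀ z k x l - 1‖ ≤ C * |x / (N : ℝ) ^ (l * p)| := by
  obtain ⟨K, hK⟩ := hLip
  have hN : 0 < (N : ℝ) := by exact_mod_cast NeZero.pos N
  have hs := Real.sqrt_pos.mpr hN
  refine ⟨∑ j ∈ Finset.range p, K * (N : ℝ) ^ j / Real.sqrt N, fun x l => ?_⟩
  set y := x / (N : ℝ) ^ (l * p)
  have hph : cyclePhase m₀ z ≠ 0 := norm_ne_zero_iff.mp (by rw [hz.norm_cyclePhase]; simp)
  have hone : (1 : ℂ) = (cyclePhase m₀ z)⁻¹ * ∏ j ∈ Finset.range p,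
      (m₀ (z k ^ N ^ j) / (Real.sqrt N : ℂ)) := by
    have h2 : ∏ j ∈ Finset.range p, (m₀ (z k ^ N ^ j) / (Real.sqrt N : ℂ)) = cyclePhase m₀ z := by
      rw [hz.cyclePhase_eq, ← prod_range_finRotate_pow hz.1.1 k]
      exact Finset.prod_congr rfl fun j _ => by rw [hz.1.pow_eq]
    rw [h2, inv_mul_cancel₀ hph]
  rw [phiFactor_eq]
  rw [hone, ← mul_sub, norm_mul, norm_inv, hz.norm_cyclePhase, inv_one, one_mul, Finset.sum_mul]
  refine (norm_prod_sub_prod_le (fun _ => norm_div_sqrt_le_one hR1 _)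
    (fun _ => norm_div_sqrt_le_one hR1 _) p).trans (Finset.sum_le_sum fun j _ => ?_)
  rw [← sub_div, norm_div, Complex.norm_real, Real.norm_of_nonneg hs.le, div_mul_eq_mul_div]
  gcongr
  rw [← dist_eq_norm]
  refine (hK.dist_le_mul _ _).trans ?_
  rw [mul_assoc]
  gcongr
  obtain ⟨a, ha⟩ := Circle.exp_surjective (z k)
  rw [← ha, ← Circle.exp_add, ← Circle.exp_natCast_mul, ← Circle.exp_natCast_mul]
  refine (dist_circle_exp_le _ _).trans_eq ?_
  rw [← mul_sub, add_sub_cancel_left, abs_mul]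
  push_cast
  rw [abs_of_pos (pow_pos hN j)]

theorem IsMCycle.multipliable_phiFactor (hN2 : 2 ≤ N) (hz : IsMCycle N m₀ z)
    (hLip : ∃ K, LipschitzWith K m₀) (hR1 : ruelleOp N m₀ 1 = 1) (k : Fin p) (x : ℝ) :
    Multipliable fun l : ℕ => phiFactor N m₀ z k x (l + 1) := by
  obtain ⟨C, hC⟩ := hz.exists_norm_phiFactor_sub_one_le hLip hR1 k
  have hN1 : (1 : ℝ) < (N : ℝ) ^ p :=
    one_lt_pow₀ (by exact_mod_cast hN2) hz.1.1.ne'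
  have hgeo : Summable fun l : ℕ => C * |x| * (((N : ℝ) ^ p)⁻¹ ^ (l + 1)) :=
    ((summable_nat_add_iff 1).mpr (summable_geometric_of_lt_one (by positivity)
      (inv_lt_one_of_one_lt₀ hN1))).mul_left _
  have hs : Summable fun l : ℕ => ‖phiFactor N m₀ z k x (l + 1) - 1‖ := by
    refine Summable.of_nonneg_of_le (fun _ => norm_nonneg _) (fun l => ?_) hgeo
    refine (hC x (l + 1)).trans_eq ?_
    rw [abs_div, abs_of_nonneg (by positivity : (0 : ℝ) ≤ (N : ℝ) ^ ((l + 1) * p)), inv_pow,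
      ← pow_mul, mul_comm p, mul_assoc, div_eq_mul_inv]
  simpa using multipliable_one_add_of_summable hs

/-- The factors group the steps of the backward path into blocks of the length of the cycle. -/
theorem IsMCycle.norm_sq_phiFactor (hz : IsMCycle N m₀ z) (k : Fin p) (x : ℝ) (l : ℕ) :
    ‖phiFactor N m₀ z k x (l + 1)‖ ^ 2 = ∏ j ∈ Finset.range p, weight N m₀
      (pathPt N (cyclePath z (finRotate p)⁻¹ k) x (l * p + j + 1)) := by
  have hN : 0 < (N : ℝ) := by exact_mod_cast NeZero.pos N
  set u := cyclePath z (finRotate p)⁻¹ k with hu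
  have hu' : ∀ n, u (n + 1) ^ N = u n :=
    cyclePath_succ_pow (pr := (finRotate p)⁻¹) hz.inv_finRotate_pow k
  have hpt : z k * Circle.exp (x / (N : ℝ) ^ ((l + 1) * p)) = pathPt N u x ((l + 1) * p) := by
    rw [pathPt, hu, cyclePath_finRotate_mul]
  rw [phiFactor_eq, norm_mul, norm_inv, hz.norm_cyclePhase, inv_one, one_mul, norm_prod,
    ← Finset.prod_pow, hpt, ← Finset.prod_range_reflect]
  refine Finset.prod_congr rfl fun j hj => ?_
  have hj' := Finset.mem_range.mp hj
  rw [norm_div, div_pow, Complex.norm_real, Real.norm_of_nonneg (Real.sqrt_nonneg _),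
    Real.sq_sqrt hN.le, weight]
  rw [← pathPt_pow hu' x (l * p + j + 1) (p - 1 - j),
    show l * p + j + 1 + (p - 1 - j) = (l + 1) * p by rw [Nat.succ_mul]; omega]

theorem IsMCycle.prod_norm_sq_phiFactor (hz : IsMCycle N m₀ z) (k : Fin p) (x : ℝ) (n : ℕ) :
    ∏ l ∈ Finset.range n, ‖phiFactor N m₀ z k x (l + 1)‖ ^ 2 =
      pathProd N (weight N m₀) (cyclePath z (finRotate p)⁻¹ k) (n * p) x := by
  induction n with
  | zero => simp [pathProd]
  | succ n ih =>
    rw [Finset.prod_range_succ, ih, hz.norm_sq_phiFactor, pathProd, pathProd, Nat.succ_mul,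
      Finset.prod_range_add]

theorem IsMCycle.norm_sq_phi (hN2 : 2 ≤ N) (hz : IsMCycle N m₀ z)
    (hLip : ∃ K, LipschitzWith K m₀) (hR1 : ruelleOp N m₀ 1 = 1) (k : Fin p) (x : ℝ) :
    ‖phi N m₀ z k x‖ ^ 2 = pathLim N (weight N m₀) (cyclePath z (finRotate p)⁻¹ k) x := by
  have h1 := (hz.multipliable_phiFactor hN2 hLip hR1 k x).hasProd.tendsto_prod_nat.norm.pow 2
  have h2 := (tendsto_pathProd (N := N) (u := cyclePath z (finRotate p)⁻¹ k)
    (weight_nonneg N m₀) (weight_le_one (weight_nonneg N m₀) (sum_weight hR1)) x).comp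
    (Filter.tendsto_id.atTop_mul_const' hz.1.1)
  refine tendsto_nhds_unique h1 (h2.congr fun n => ?_)
  rw [Function.comp_apply, id, ← hz.prod_norm_sq_phiFactor, norm_prod, Finset.prod_pow]

theorem IsMCycle.gFun_eq (hN2 : 2 ≤ N) (hz : IsMCycle N m₀ z)
    (hLip : ∃ K, LipschitzWith K m₀) (hR1 : ruelleOp N m₀ 1 = 1) (k : Fin p) (t : Circle) :
    gFun N m₀ z k t = (hitProb N (weight N m₀) (cyclePath z (finRotate p)⁻¹ k) t : ℂ) := by
  rw [gFun, rot, toCircleFun, Per, hitProb, pathSum, Complex.ofReal_tsum]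
  exact tsum_congr fun j => by rw [hz.norm_sq_phi hN2 hLip hR1]; rfl

end Phi

theorem integrable_of_sum_translates_le {f : ℝ → ℝ} (hc : Continuous f) (h0 : ∀ x, 0 ≤ f x)
    (hs : ∀ y, Summable fun j : ℤ => f (y + 2 * j * Real.pi))
    (h1 : ∀ y, ∑' j : ℤ, f (y + 2 * j * Real.pi) ≤ 1) : MeasureTheory.Integrable f := by
  have hpi := Real.pi_pos
  have hint : ∀ a b : ℝ, IntervalIntegrable f MeasureTheory.volume a b :=
    fun a b => hc.intervalIntegrable a b
  have hT : Filter.Tendsto (fun n : ℕ => 2 * Real.pi * (n : ℝ)) Filter.atTop Filter.atTop :=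
    tendsto_natCast_atTop_atTop.const_mul_atTop (by positivity)
  refine MeasureTheory.integrable_of_intervalIntegral_norm_bounded (2 * Real.pi)
    (l := Filter.atTop) (a := fun n : ℕ => -(2 * Real.pi * (n : ℝ)))
    (b := fun n : ℕ => 2 * Real.pi * (n : ℝ)) (fun n => hc.integrableOn_Ioc)
    (Filter.tendsto_neg_atTop_atBot.comp hT) hT (Filter.Eventually.of_forall fun n => ?_)
  simp only [Real.norm_of_nonneg (h0 _)]
  set a : ℕ → ℝ := fun k => 2 * ((k : ℤ) - n : ℤ) * Real.pi with ha
  have h2 : ∫ x in -(2 * Real.pi * (n : ℝ))..2 * Real.pi * (n : ℝ), f x =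
      ∑ k ∈ Finset.range (2 * n), ∫ x in a k..a (k + 1), f x := by
    rw [intervalIntegral.sum_integral_adjacent_intervals fun k _ => hint _ _]
    congr 1
    · simp only [ha]; push_cast; ring
    · simp only [ha]; push_cast; ring
  have h3 : ∀ k, ∫ x in a k..a (k + 1), f x =
      ∫ x in (0 : ℝ)..2 * Real.pi, f (x + 2 * ((k : ℤ) - n : ℤ) * Real.pi) := by
    intro k
    rw [intervalIntegral.integral_comp_add_right (f := f)]
    congr 1
    · simp only [ha]; ring
    · simp only [ha]; push_cast; ring
  rw [h2, Finset.sum_congr rfl fun k _ => h3 k, ← intervalIntegral.integral_finsetSum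
    (f := fun (k : ℕ) x => f (x + 2 * ((k : ℤ) - n : ℤ) * Real.pi))
    fun k _ => (hc.comp (by fun_prop)).intervalIntegrable _ _]
  calc _ ≤ ∫ x in (0 : ℝ)..2 * Real.pi, (1 : ℝ) := by
        refine intervalIntegral.integral_mono (by positivity)
          ((continuous_finsetSum _ fun k _ => hc.comp (by fun_prop)).intervalIntegrable _ _)
          (continuous_const.intervalIntegrable _ _) fun y => ?_
        refine le_trans ?_ (h1 y)
        have h4 := (hs y).sum_le_tsum
          ((Finset.range (2 * n)).map ⟨fun k : ℕ => (k : ℤ) - n, fun a b h => by simpa using h⟩)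
          fun _ _ => h0 _
        rw [Finset.sum_map] at h4
        exact h4
    _ = 2 * Real.pi := by simp

/-! ### Lists of cycles and the basis of the eigenspaces -/

theorem IsCycle.exists_pow_eq {N p : ℕ} {z : Fin p → Circle} (hz : IsCycle N z) (k k' : Fin p) :
    ∃ j : ℕ, z k ^ N ^ j = z k' := by
  obtain ⟨n, rfl⟩ := Nat.exists_eq_succ_of_ne_zero hz.1.ne'
  refine ⟨(k' - k : Fin (n + 1)), ?_⟩
  rw [hz.pow_eq, finRotate_pow_apply, show Fin.ofNat (n + 1) ((k' - k : Fin (n + 1)) : ℕ) = k' - k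
    from Fin.ext (Nat.mod_eq_of_lt (k' - k).2), add_sub_cancel]

/-- Two cycles with a common point have the same points. -/
theorem IsCycle.range_subset {N p q : ℕ} {z : Fin p → Circle} {w : Fin q → Circle}
    (hz : IsCycle N z) (hw : IsCycle N w) {k : Fin p} {l : Fin q} (h : z k = w l) :
    Set.range z ⊆ Set.range w := by
  rintro _ ⟨k', rfl⟩
  obtain ⟨j, hj⟩ := hz.exists_pow_eq k k'
  exact ⟨(finRotate q ^ j) l, by rw [← hw.pow_eq, ← h, hj]⟩

theorem mul_zpow_neg_finRotate {p : ℕ} {lam : ℂ} (hlam : lam ≠ 0) (hp : lam ^ p = 1) (k : Fin p) :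
    lam * lam ^ (-((finRotate p k : ℕ) : ℤ)) = lam ^ (-((k : ℕ) : ℤ)) := by
  obtain ⟨n, rfl⟩ := Nat.exists_eq_succ_of_ne_zero (Nat.ne_of_gt k.pos)
  rcases Nat.lt_or_ge (k : ℕ) n with h | h
  · rw [coe_finRotate_of_ne_last (by rw [Ne, Fin.ext_iff, Fin.val_last]; omega),
      ← zpow_one_add₀ hlam]
    congr 1
    push_cast
    ring
  · have hk : k = Fin.last n := by rw [Fin.ext_iff, Fin.val_last]; omega
    rw [hk, finRotate_last, Fin.val_zero, Fin.val_last, Nat.cast_zero, neg_zero, zpow_zero,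
      mul_one, zpow_neg, zpow_natCast]
    refine eq_inv_of_mul_eq_one_left ?_
    rw [← pow_succ', hp]

section List

variable {N : ℕ} {n : ℕ} {p : Fin n → ℕ} {z : (i : Fin n) → Fin (p i) → Circle}

/-- The predecessor permutation on the points of all the cycles of a list. -/
def predPerm (p : Fin n → ℕ) : Equiv.Perm (Σ i, Fin (p i)) :=
  Equiv.sigmaCongrRight fun i => (finRotate (p i))⁻¹

theorem predPerm_pow (m : ℕ) (i : Fin n) (k : Fin (p i)) :
    (predPerm p ^ m) ⟨i, k⟩ = ⟨i, ((finRotate (p i))⁻¹ ^ m) k⟩ := by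
  induction m with
  | zero => rfl
  | succ m ih => rw [pow_succ', Equiv.Perm.mul_apply, ih, pow_succ', Equiv.Perm.mul_apply]; rfl

theorem predPerm_finRotate (i : Fin n) (k : Fin (p i)) :
    predPerm p ⟨i, finRotate (p i) k⟩ = ⟨i, k⟩ :=
  congrArg (Sigma.mk i) ((finRotate (p i)).symm_apply_apply k)

theorem cyclePath_predPerm (i : Fin n) (k : Fin (p i)) :
    cyclePath (fun a : Σ i, Fin (p i) => z a.1 a.2) (predPerm p) ⟨i, k⟩ =
      cyclePath (z i) (finRotate (p i))⁻¹ k := by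
  funext m
  rw [cyclePath, predPerm_pow]
  rfl

theorem IsMCycleList.injective {m₀ : Circle → ℂ} (hl : IsMCycleList N m₀ p z) :
    Function.Injective fun a : Σ i, Fin (p i) => z a.1 a.2 := by
  rintro ⟨i, k⟩ ⟨i', k'⟩ h
  have h' : z i k = z i' k' := h
  have hi : i = i' := hl.2.1 (Set.Subset.antisymm ((hl.1 i).1.range_subset (hl.1 i').1 h')
    ((hl.1 i').1.range_subset (hl.1 i).1 h'.symm))
  subst hi
  rw [(hl.1 i).1.2.1 h']

theorem IsMCycleList.pow_predPerm {m₀ : C(Circle, ℂ)} (hl : IsMCycleList N m₀ p z)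
    (a : Σ i, Fin (p i)) : z (predPerm p a).1 (predPerm p a).2 ^ N = z a.1 a.2 :=
  (hl.1 a.1).inv_finRotate_pow a.2

variable [NeZero N]

theorem IsMCycleList.mem_range {m₀ : Circle → ℂ} (hl : IsMCycleList N m₀ p z) {c : Circle}
    (hc : IsCyclePt N (weight N m₀) c) :
    c ∈ Set.range fun a : Σ i, Fin (p i) => z a.1 a.2 := by
  obtain ⟨q, w, hw, hcw⟩ := hc.exists_isMCycle
  have hmem : Set.range w ∈ Set.range fun i => Set.range (z i) := by
    rw [hl.2.2]; exact ⟨q, w, hw, rfl⟩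
  obtain ⟨i, hi⟩ := hmem
  rw [← show Set.range (z i) = Set.range w from hi] at hcw
  obtain ⟨k, rfl⟩ := hcw
  exact ⟨⟨i, k⟩, rfl⟩

variable {m₀ : C(Circle, ℂ)} (hl : IsMCycleList N m₀ p z) (hN : 2 ≤ N)
  (hLip : ∃ K, LipschitzWith K m₀) (hR1 : ruelleOp N m₀ 1 = 1)

include hl hN hLip hR1 in
theorem IsMCycleList.gFun_eq (i : Fin n) (k : Fin (p i)) (t : Circle) :
    gFun N m₀ (z i) k t = (hitProb N (weight N m₀) (cyclePath
      (fun a : Σ i, Fin (p i) => z a.1 a.2) (predPerm p) ⟨i, k⟩) t : ℂ) := by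
  rw [cyclePath_predPerm]
  exact (hl.1 i).gFun_eq hN hLip hR1 k t

include hl hN hLip hR1 in
theorem IsMCycleList.integrable_phi (i : Fin n) (k : Fin (p i)) :
    MeasureTheory.Integrable (fun x : ℝ => ‖phi N m₀ (z i) k x‖ ^ 2) ∧
      ∀ x : ℝ, Summable fun j : ℤ => ‖phi N m₀ (z i) k (x + 2 * j * Real.pi)‖ ^ 2 := by
  obtain ⟨L, -, hL⟩ := exists_weight_exp_lipschitz N hLip
  have hW := weight_nonneg N m₀
  have hsum := sum_weight hR1
  have hs := summable_pathLim hN hW hsum hl.injective hl.pow_predPerm ⟨i, k⟩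
  have h1 := pathSum_le_one hN hW hsum hl.injective hl.pow_predPerm ⟨i, k⟩
  rw [cyclePath_predPerm] at hs h1
  simp only [(hl.1 i).norm_sq_phi hN hLip hR1]
  exact ⟨integrable_of_sum_translates_le
    (continuous_pathLim hN hW (weight_le_one hW hsum) hL) (pathLim_nonneg hW) hs h1, hs⟩

include hl hN hLip hR1 in
/-- `R` moves the functions `g` one step along their cycle. -/
theorem IsMCycleList.sum_weight_mul_gFun (i : Fin n) (k : Fin (p i)) (t : Circle) :
    ∑ w ∈ preim N t, (weight N m₀ w : ℂ) * gFun N m₀ (z i) k w =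
      gFun N m₀ (z i) (finRotate (p i) k) t := by
  have h := sum_weight_mul_hitProb_cyclePath hN (weight_nonneg N m₀) (sum_weight hR1)
    hl.injective hl.pow_predPerm ⟨i, finRotate (p i) k⟩ t
  rw [predPerm_finRotate] at h
  simp only [hl.gFun_eq hN hLip hR1]
  exact_mod_cast h

include hl hN hLip hR1 in
theorem IsMCycleList.ruelleFun_eigenFun {lam : ℂ} (hlam : lam ≠ 0) {i : Fin n}
    (hi : lam ^ p i = 1) (t : Circle) :
    ∑ w ∈ preim N t, (weight N m₀ w : ℂ) * eigenFun N m₀ (z i) lam w =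
      lam * eigenFun N m₀ (z i) lam t := by
  simp only [eigenFun, Finset.mul_sum]
  rw [Finset.sum_comm, ← Equiv.sum_comp (finRotate (p i)) fun k => lam * (lam ^ (-((k : ℕ) : ℤ)) *
    gFun N m₀ (z i) k t)]
  refine Finset.sum_congr rfl fun k _ => ?_
  rw [← mul_assoc, mul_zpow_neg_finRotate hlam hi, ← hl.sum_weight_mul_gFun hN hLip hR1,
    Finset.mul_sum]
  exact Finset.sum_congr rfl fun w _ => by ring

include hl hN hLip hR1 in
/-- The function belonging to a cycle is `1` at its starting point and `0` at the starting
points of the other cycles. -/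
theorem IsMCycleList.eigenFun_apply (lam : ℂ) (i i' : Fin n) :
    eigenFun N m₀ (z i) lam (z i' ⟨0, (hl.1 i').1.1⟩) = if i = i' then 1 else 0 := by
  have hv : ∀ k, gFun N m₀ (z i) k (z i' ⟨0, (hl.1 i').1.1⟩) =
      if (⟨i, k⟩ : Σ i, Fin (p i)) = ⟨i', ⟨0, (hl.1 i').1.1⟩⟩ then 1 else 0 := by
    intro k
    rw [hl.gFun_eq hN hLip hR1]
    have h := hitProb_apply_pt hN (weight_nonneg N m₀) (sum_weight hR1) hl.injective
      hl.pow_predPerm (fun a => (hl.1 a.1).weight_eq_one a.2) ⟨i, k⟩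
      ⟨i', ⟨0, (hl.1 i').1.1⟩⟩
    simp only at h
    rw [h]
    split_ifs <;> simp
  simp only [eigenFun, hv]
  split_ifs with h
  · subst h
    rw [Finset.sum_eq_single_of_mem ⟨0, (hl.1 i).1.1⟩ (Finset.mem_univ _)]
    · simp
    · intro k _ hk
      have hne : (⟨i, k⟩ : Σ i, Fin (p i)) ≠ ⟨i, ⟨0, (hl.1 i).1.1⟩⟩ :=
        fun h => hk (eq_of_heq (Sigma.mk.inj h).2)
      rw [if_neg hne, mul_zero]
  · refine Finset.sum_eq_zero fun k _ => ?_
    rw [if_neg fun h' => h (Sigma.mk.inj h').1, mul_zero]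

variable (hzeros : {z : Circle | m₀ z = 0}.Finite) (h1 : weight N m₀ 1 = 1)

include hl hN hLip hR1 hzeros h1 in
theorem IsMCycleList.continuous_eigenFun (lam : ℂ) (i : Fin n) :
    Continuous (eigenFun N m₀ (z i) lam) := by
  obtain ⟨L, -, hL⟩ := exists_weight_exp_lipschitz N hLip
  refine continuous_finsetSum _ fun k _ => continuous_const.mul ?_
  rw [funext (hl.gFun_eq hN hLip hR1 i k)]
  exact Complex.continuous_ofReal.comp (continuous_hitProb hN (weight_nonneg N m₀)
    (sum_weight hR1) hl.injective hl.pow_predPerm hL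
    (fun a => (hl.1 a.1).weight_eq_one a.2) (by simpa only [weight_eq_zero] using hzeros) h1
    (fun c hc => hl.mem_range hc) ⟨i, k⟩)

include hR1 in
theorem IsMCycle.apply_eq_of_eigen {q : ℕ} {w : Fin q → Circle} (hw : IsMCycle N m₀ w) {lam : ℂ}
    {f : C(Circle, ℂ)} (hf : ruelleOp N m₀ f = lam • f) (k : Fin q) (j : ℕ) :
    f (w k) = lam ^ j * f (w ((finRotate q ^ j) k)) := by
  induction j with
  | zero => simp
  | succ j ih =>
    have h2 := congrArg (fun g : C(Circle, ℂ) => g (w ((finRotate q ^ j) k) ^ N)) hf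
    simp only [ruelleOp_eq_sum, ContinuousMap.smul_apply, smul_eq_mul] at h2
    rw [sum_weight_mul_of_eq_one (weight_nonneg N m₀) (sum_weight hR1) (hw.weight_eq_one _),
      hw.1.2.2] at h2
    rw [ih, h2, pow_succ' (finRotate q), Equiv.Perm.mul_apply, pow_succ, mul_assoc]

include hl hN hR1 hzeros h1 in
/-- An eigenfunction is determined by its values at the starting points of the cycles whose
length `p` satisfies `λ ^ p = 1`. -/
theorem IsMCycleList.eq_zero_of_eigen {lam : ℂ} (hlam : ‖lam‖ = 1) {f : C(Circle, ℂ)}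
    (hf : ruelleOp N m₀ f = lam • f)
    (h0 : ∀ i, lam ^ p i = 1 → f (z i ⟨0, (hl.1 i).1.1⟩) = 0) : f = 0 := by
  have hlam0 : lam ≠ 0 := norm_ne_zero_iff.mp (by rw [hlam]; exact one_ne_zero)
  refine eq_zero_of_forall_isCyclePt hN hzeros hR1 h1 hlam hf fun c hc => ?_
  obtain ⟨⟨i, k⟩, rfl⟩ := hl.mem_range hc
  change f (z i k) = 0
  by_cases hi : lam ^ p i = 1
  · obtain ⟨j, hj⟩ := (hl.1 i).1.exists_pow_eq ⟨0, (hl.1 i).1.1⟩ k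
    have h2 := (hl.1 i).apply_eq_of_eigen hR1 hf ⟨0, (hl.1 i).1.1⟩ j
    rw [h0 i hi, ← (hl.1 i).1.pow_eq, hj] at h2
    exact (mul_eq_zero.mp h2.symm).resolve_left (pow_ne_zero j hlam0)
  · have h2 := (hl.1 i).apply_eq_of_eigen hR1 hf k (p i)
    rw [finRotate_pow_self] at h2
    have h3 : (1 - lam ^ p i) * f (z i k) = 0 := by
      rw [sub_mul, one_mul]; exact sub_eq_zero.mpr h2
    exact (mul_eq_zero.mp h3).resolve_left fun h => hi (sub_eq_zero.mp h).symm

include hl hN hLip hR1 hzeros h1 in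
/-- Evaluation at the starting points of the cycles identifies the eigenspace with a coordinate
space; the functions `eigenFun` correspond to the unit vectors. -/
theorem IsMCycleList.exists_basis {lam : ℂ} (hlam : ‖lam‖ = 1) :
    ∃ b : Module.Basis {i : Fin n // lam ^ p i = 1} ℂ (Module.End.eigenspace
        (ruelleOp N m₀ : C(Circle, ℂ) →ₗ[ℂ] C(Circle, ℂ)) lam),
      ∀ (i : {i : Fin n // lam ^ p i = 1}) (t : Circle),
        (b i : C(Circle, ℂ)) t = eigenFun N m₀ (z i.1) lam t := by
  classical
  have hlam0 : lam ≠ 0 := norm_ne_zero_iff.mp (by rw [hlam]; exact one_ne_zero)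
  set E := Module.End.eigenspace (ruelleOp N m₀ : C(Circle, ℂ) →ₗ[ℂ] C(Circle, ℂ)) lam with hE
  let e : {i : Fin n // lam ^ p i = 1} → E := fun i =>
    ⟨⟨eigenFun N m₀ (z i.1) lam, hl.continuous_eigenFun hN hLip hR1 hzeros h1 lam i.1⟩, by
      rw [hE, mem_eigenspace_ruelleOp_iff]
      ext t
      rw [ruelleOp_eq_sum]
      exact hl.ruelleFun_eigenFun hN hLip hR1 hlam0 i.2 t⟩
  let ev : E →ₗ[ℂ] ({i : Fin n // lam ^ p i = 1} → ℂ) :=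
    { toFun := fun f i => (f : C(Circle, ℂ)) (z i.1 ⟨0, (hl.1 i.1).1.1⟩)
      map_add' := fun f g => rfl
      map_smul' := fun c f => rfl }
  have hev : ∀ i, ev (e i) = Pi.single i 1 := by
    intro i
    funext i'
    refine (hl.eigenFun_apply hN hLip hR1 lam i.1 i'.1).trans ?_
    rw [Pi.single_apply]
    simp only [Subtype.ext_iff, eq_comm]
  have hinj : Function.Injective ev := by
    rw [injective_iff_map_eq_zero]
    intro f hf
    refine Subtype.ext (hl.eq_zero_of_eigen hN hR1 hzeros h1 hlam
      (mem_eigenspace_ruelleOp_iff.mp f.2) fun i hi => ?_)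
    exact congrFun hf ⟨i, hi⟩
  have hsurj : Function.Surjective ev := by
    intro v
    refine ⟨∑ i, v i • e i, ?_⟩
    rw [map_sum]
    simp only [map_smul, hev]
    exact (pi_eq_sum_univ' v).symm
  let E' := LinearEquiv.ofBijective ev ⟨hinj, hsurj⟩
  refine ⟨Module.Basis.ofEquivFun E', fun i t => ?_⟩
  have hb : Module.Basis.ofEquivFun E' i = e i := by
    rw [Module.Basis.coe_ofEquivFun, LinearEquiv.symm_apply_eq]
    exact (hev i).symm
  rw [hb]
  rfl

end List

end Galerkin

theorem theorem2p1 (N : ℕ) (hN : 2 ≤ N) (m₀ : C(Circle, ℂ))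
    (hLip : ∃ K, LipschitzWith K m₀)
    (hzeros : {z : Circle | m₀ z = 0}.Finite)
    (hlow : m₀ 1 = (Real.sqrt N : ℂ))
    (hR1 : Galerkin.ruelleOp N m₀ 1 = 1) :
    spectralRadius ℂ (Galerkin.ruelleOp N m₀) = 1 ∧
    -- the open disk consists of eigenvalues of infinite multiplicity
    (∀ lam : ℂ, ‖lam‖ < 1 →
      Module.End.HasEigenvalue
        (Galerkin.ruelleOp N m₀ : C(Circle, ℂ) →ₗ[ℂ] C(Circle, ℂ)) lam ∧
      ¬ FiniteDimensional ℂ (Module.End.eigenspace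
        (Galerkin.ruelleOp N m₀ : C(Circle, ℂ) →ₗ[ℂ] C(Circle, ℂ)) lam)) ∧
    spectrum ℂ (Galerkin.ruelleOp N m₀) = {lam : ℂ | ‖lam‖ ≤ 1} ∧
    -- peripheral spectrum: there are finitely many cycles, and for any listing of them ...
    (Galerkin.mCycles N m₀).Finite ∧
    ∀ (n : ℕ) (p : Fin n → ℕ) (z : (i : Fin n) → Fin (p i) → Circle),
      Galerkin.IsMCycleList N m₀ p z →
      -- the functions `φ_{ki}` and `Per |φ_{ki}|²` are well defined
      (∀ (i : Fin n) (k : Fin (p i)),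
        (∀ x : ℝ, Multipliable fun l : ℕ => Galerkin.phiFactor N m₀ (z i) k x (l + 1)) ∧
        MeasureTheory.Integrable (fun x : ℝ => ‖Galerkin.phi N m₀ (z i) k x‖ ^ 2) ∧
        ∀ x : ℝ, Summable fun j : ℤ =>
          ‖Galerkin.phi N m₀ (z i) k (x + 2 * j * Real.pi)‖ ^ 2) ∧
      ∀ lam : ℂ, ‖lam‖ = 1 →
        (Module.End.HasEigenvalue
          (Galerkin.ruelleOp N m₀ : C(Circle, ℂ) →ₗ[ℂ] C(Circle, ℂ)) lam ↔
            ∃ i, lam ^ p i = 1) ∧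
        Module.rank ℂ (Module.End.eigenspace
          (Galerkin.ruelleOp N m₀ : C(Circle, ℂ) →ₗ[ℂ] C(Circle, ℂ)) lam) =
            (Nat.card {i : Fin n // lam ^ p i = 1} : Cardinal) ∧
        (∃ b : Module.Basis {i : Fin n // lam ^ p i = 1} ℂ (Module.End.eigenspace
            (Galerkin.ruelleOp N m₀ : C(Circle, ℂ) →ₗ[ℂ] C(Circle, ℂ)) lam),
          ∀ (i : {i : Fin n // lam ^ p i = 1}) (t : Circle),
            (b i : C(Circle, ℂ)) t = Galerkin.eigenFun N m₀ (z i.1) lam t) ∧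
        (∀ i : Fin n, lam ^ p i = 1 →
          (∃ K, LipschitzWith K (Galerkin.eigenFun N m₀ (z i) lam)) ∧
          (Galerkin.IsTrigPoly m₀ →
            Galerkin.IsTrigPoly (Galerkin.eigenFun N m₀ (z i) lam))) := by
  have : NeZero N := ⟨by omega⟩
  have h1 : Galerkin.weight N m₀ 1 = 1 := Galerkin.weight_eq_one.mpr (by
    rw [hlow, Complex.norm_real, Real.norm_of_nonneg (Real.sqrt_nonneg _)])
  refine ⟨Galerkin.spectralRadius_ruelleOp hN hR1 h1, fun lam hlam =>
    ⟨Galerkin.hasEigenvalue_of_norm_lt_one hN hR1 h1 hlam,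
      Galerkin.not_finiteDimensional_eigenspace hN hR1 h1 hlam⟩,
    Galerkin.spectrum_ruelleOp hN hR1 h1, Galerkin.finite_mCycles hN hzeros hR1,
    fun n p z hl => ⟨fun i k => ⟨(hl.1 i).multipliable_phiFactor hN hLip hR1 k,
      hl.integrable_phi hN hLip hR1 i k⟩, fun lam hlam => ?_⟩⟩
  obtain ⟨b, hb⟩ := hl.exists_basis hN hLip hR1 hzeros h1 hlam
  have hfun : ∀ i : {i : Fin n // lam ^ p i = 1},
      ((b i : C(Circle, ℂ)) : Circle → ℂ) = Galerkin.eigenFun N m₀ (z i.1) lam :=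
    fun i => funext (hb i)
  have heig : ∀ i, Galerkin.ruelleOp N m₀ (b i) = lam • (b i : C(Circle, ℂ)) :=
    fun i => Galerkin.mem_eigenspace_ruelleOp_iff.mp (b i).2
  classical
  refine ⟨⟨fun h => ?_, ?_⟩, ?_, ⟨b, hb⟩, fun i hi => ⟨?_, fun hm => ?_⟩⟩
  · by_contra! hne
    have : IsEmpty {i : Fin n // lam ^ p i = 1} := ⟨fun i => hne i.1 i.2⟩
    obtain ⟨f, hf, hf0⟩ := h.exists_hasEigenvector
    have hf' := b.ext_elem (x := ⟨f, hf⟩) (y := 0) fun i => isEmptyElim i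
    exact hf0 (congrArg Subtype.val hf')
  · rintro ⟨i, hi⟩
    exact Module.End.hasEigenvalue_of_hasEigenvector
      ⟨(b ⟨i, hi⟩).2, fun h0 => b.ne_zero ⟨i, hi⟩ (Subtype.ext h0)⟩
  · rw [rank_eq_card_basis b, Nat.card_eq_fintype_card]
  · rw [← hfun ⟨i, hi⟩]
    exact Galerkin.exists_lipschitzWith_of_eigen hN hLip hR1 hlam (heig ⟨i, hi⟩)
  · rw [← hfun ⟨i, hi⟩]
    exact Galerkin.isTrigPoly_of_eigen hN hR1 hm hlam (heig ⟨i, hi⟩)
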